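/- Let $\sigma,\nu>0$, $\theta,r\in\mathbb R$ with $1-\theta\nu-\frac{\sigma^2\nu}{2}>0$, let $S_0,K>0$, and put $\omega=\frac1\nu\log\bigl(1-\theta\nu-\frac{\sigma^2\nu}{2}\bigr)$. Let $X$ be a Variance Gamma process with parameters $(\sigma,\nu,\theta)$ on a filtered probability space $(\Omega,(\mathcal F_t)_{t\ge0},\mathbb Q)$: $X_0=0$ a.s., $X$ is adapted, and for $s<t$ the increment $X_t-X_s$ is independent of $\mathcal F_s$ and is distributed as $\theta\gamma+\sigma\sqrt{\gamma}\,Z$, where $\gamma$ has the Gamma distribution with mean $t-s$ and variance $\nu(t-s)$, and $Z$ is a standard normal variable independent of $\gamma$. Let $S_t=S_0e^{(r+\omega)t+X_t}$. For $0\le t<T$ put $\tau=T-t$ and $$\alpha=\tfrac{\tau}{\nu}-\tfrac12,\quad \sigma_\nu=\sigma\sqrt{\tfrac{\nu}{2}},\quad \theta_\sigma=\tfrac{\theta}{\sigma^2},\quad q=\tfrac{1}{2\sigma^2\nu}+\Bigl(\tfrac{\theta}{2\sigma^2}\Bigr)^2,\quad k=\log\tfrac{S_t}{K}+r\tau+\omega\tau,$$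 and assume $\alpha\notin\mathbb Z$. Let $$C=\mathbb E^{\mathbb Q}\bigl[e^{-r\tau}\mathbf 1_{\{S_T>K\}}\,\big|\,\mathcal F_t\bigr]$$ be the value at time $t$ of the cash-or-nothing call with strike $K$ and maturity $T$. For $\kappa<0$ and $\vartheta\in\{\theta_\sigma,-\theta_\sigma\}$ write $$C^-(\kappa,q,\sigma_\nu,\vartheta)=A\Bigl[\sum_{n=0}^\infty a_n(\vartheta)+2\sum_{n_1,n_2=0}^\infty b_{n_1,n_2}(\kappa,\vartheta)\Bigr],\qquad A=\frac{e^{-r\tau}}{2^{2+2\alpha}\sqrt\pi\,\sigma_\nu^{1+2\alpha}\,\Gamma(\frac\tau\nu)},$$ $$a_n(\vartheta)=\frac{1}{n!}\Gamma\Bigl(\frac{n+1}{2}\Bigr)\Gamma\Bigl(\frac{n+1}{2}+\alpha\Bigr)q^{-\frac{n+1}{2}-\alpha}\,\vartheta^n,$$ $$b_{n_1,n_2}(\kappa,\vartheta)=\frac{(-1)^{n_1}}{n_1!\,n_2!}\Bigl(\frac{\Gamma(\alpha-n_1)}{-2n_1-n_2-1}(-\kappa)^{2n_1+n_2+1}q^{-\alpha+n_1}+\frac{\Gamma(-\alpha-n_1)}{-2n_1-n_2-1-2\alpha}(-\kappa)^{2n_1+n_2+1+2\alpha}q^{n_1}\Bigr)\vartheta^{n_2},$$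 with the convention $0^0=1$. Then all these series converge absolutely and, almost surely: (i) (out of the money) if $k<0$, then $C=C^-(k,q,\sigma_\nu,\theta_\sigma)$; (ii) (in the money) if $k>0$, then $C=e^{-r\tau}-C^-(-k,q,\sigma_\nu,-\theta_\sigma)$; (iii) (at the money) if $k=0$, then $C=A\sum_{n=0}^\infty a_n(\theta_\sigma)$. -/

import Mathlib

open MeasureTheory ProbabilityTheory
open scoped NNReal

noncomputable section

namespace VarianceGamma

/-- The law at time `t > 0` of a drifted Brownian motion `θ y + σ W(y)` evaluated at an
independent Gamma random time `y = γ(t)` of mean `t` and variance `ν t`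
(shape `t / ν`, rate `1 / ν`); `W(y)` is written as `√y Z` with `Z` standard normal. -/
def vgLaw (σ ν θ t : ℝ) : Measure ℝ :=
  ((gammaMeasure (t / ν) (1 / ν)).prod (gaussianReal 0 1)).map
    (fun p : ℝ × ℝ => θ * p.1 + σ * (Real.sqrt p.1 * p.2))

/-- `X` is a Variance Gamma process with respect to the filtration `ℱ`: the Lévy process started
at `0` whose increments over a time span `t - s` are independent of the past and have
the Variance Gamma law `vgLaw σ ν θ (t - s)`.  No path regularity is imposed, so that every
version of the process is allowed. -/
structure IsVGProcess {Ω : Type*} {mΩ : MeasurableSpace Ω} (Q : Measure Ω)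
    (ℱ : Filtration ℝ≥0 mΩ) (σ ν θ : ℝ) (X : ℝ≥0 → Ω → ℝ) : Prop where
  zero : ∀ᵐ ω ∂Q, X 0 ω = 0
  adapted : Adapted ℱ X
  indep : ∀ s t : ℝ≥0, s < t →
    Indep (MeasurableSpace.comap (fun ω => X t ω - X s ω) inferInstance) (ℱ s) Q
  law : ∀ s t : ℝ≥0, s < t →
    Q.map (fun ω => X t ω - X s ω) = vgLaw σ ν θ ((t : ℝ) - (s : ℝ))

/-- The martingale adjustment `ω_{σ,ν,θ}`. -/
def martingaleAdj (σ ν θ : ℝ) : ℝ :=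
  1 / ν * Real.log (1 - θ * ν - σ ^ 2 * ν / 2)

/-- The stock price `S_t = S₀ exp ((r + ω_{σ,ν,θ}) t + X_t)` of the exponential VG model. -/
def stock {Ω : Type*} (S₀ r σ ν θ : ℝ) (X : ℝ≥0 → Ω → ℝ) (t : ℝ≥0) (w : Ω) : ℝ :=
  S₀ * Real.exp ((r + martingaleAdj σ ν θ) * (t : ℝ) + X t w)

/-- The payoff `1_{S > K}` of a cash-or-nothing call. -/
def cashOrNothing (K s : ℝ) : ℝ := if K < s then 1 else 0

/-- The value at time `t` of the claim with payoff `P (S_T)` at time `T`: the risk-neutral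
conditional expectation of the discounted payoff. -/
def claimValue {Ω : Type*} {mΩ : MeasurableSpace Ω} (Q : Measure Ω) (ℱ : Filtration ℝ≥0 mΩ)
    (r : ℝ) (S : ℝ≥0 → Ω → ℝ) (P : ℝ → ℝ) (t T : ℝ≥0) : Ω → ℝ :=
  Q[fun w => Real.exp (-r * ((T : ℝ) - (t : ℝ))) * P (S T w) | ℱ t]

/-- The risk-neutral moneyness `k_{σ,ν,θ} = log (S / K) + r τ + ω_{σ,ν,θ} τ`. -/
def moneyness (S K r τ σ ν θ : ℝ) : ℝ :=
  Real.log (S / K) + r * τ + martingaleAdj σ ν θ * τ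

/-- `α = τ / ν - 1 / 2`. -/
def alpha (τ ν : ℝ) : ℝ := τ / ν - 1 / 2

/-- `σ_ν = σ √(ν / 2)`. -/
def sigmaNu (σ ν : ℝ) : ℝ := σ * Real.sqrt (ν / 2)

/-- `θ_σ = θ / σ²`. -/
def thetaSigma (σ θ : ℝ) : ℝ := θ / σ ^ 2

/-- `q_{σ,ν,θ} = 1 / (2 σ² ν) + (θ / (2 σ²))²`. -/
def qPar (σ ν θ : ℝ) : ℝ := 1 / (2 * σ ^ 2 * ν) + (θ / (2 * σ ^ 2)) ^ 2

/-- The common prefactor of the pricing series. -/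
def prefactor (r τ ν sν : ℝ) : ℝ :=
  Real.exp (-r * τ) /
    ((2 : ℝ) ^ (2 + 2 * alpha τ ν) * Real.sqrt Real.pi * sν ^ (1 + 2 * alpha τ ν)
      * Real.Gamma (τ / ν))

/-- General term of the single series. -/
def singleTerm (α q ϑ : ℝ) (n : ℕ) : ℝ :=
  1 / (n.factorial : ℝ) * Real.Gamma (((n : ℝ) + 1) / 2) * Real.Gamma (((n : ℝ) + 1) / 2 + α)
    * q ^ (-((n : ℝ) + 1) / 2 - α) * ϑ ^ n

/-- General term, indexed by `(n₁, n₂)`, of the double series. -/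
def doubleTerm (α k q ϑ : ℝ) (n : ℕ × ℕ) : ℝ :=
  (-1 : ℝ) ^ n.1 / ((n.1.factorial : ℝ) * (n.2.factorial : ℝ))
    * (Real.Gamma (α - n.1) / (-2 * (n.1 : ℝ) - n.2 - 1)
          * (-k) ^ (2 * n.1 + n.2 + 1) * q ^ (-α + (n.1 : ℝ))
      + Real.Gamma (-α - n.1) / (-2 * (n.1 : ℝ) - n.2 - 1 - 2 * α)
          * (-k) ^ (2 * (n.1 : ℝ) + n.2 + 1 + 2 * α) * q ^ n.1)
    * ϑ ^ n.2

/-- The out-of-the-money series `C⁻(k, q, σ_ν, θ_σ)`. -/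
def cMinus (r τ ν k q sν ϑ : ℝ) : ℝ :=
  prefactor r τ ν sν *
    ((∑' n : ℕ, singleTerm (alpha τ ν) q ϑ n)
      + 2 * ∑' n : ℕ × ℕ, doubleTerm (alpha τ ν) k q ϑ n)

/-- The at-the-money series `C^{atm}(q, σ_ν, θ_σ)`. -/
def cAtm (r τ ν q sν ϑ : ℝ) : ℝ :=
  prefactor r τ ν sν * ∑' n : ℕ, singleTerm (alpha τ ν) q ϑ n

end VarianceGamma

end

/-! By independence of the increment from `ℱ t`, the value is almost surely the discounted tail
probability P(Y > -k), where Y has law `vgLaw σ ν θ τ` (`claimValue_ae_eq`). Everything else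
computes this tail.

Given the Gamma time g, Y is normal with mean θg and variance σ²g. Completing the square and
rescaling v = 2σ²qg gives Y the density constant · exp(θ_σ y) · J_α(q y²), with J_a(x) = ∫₀^∞
v^(a-1) exp(-x/v - v) dv a Bessel-K type integral (`vgLaw_apply`).

Over y > 0, expand exp(θ_σ y) and integrate each moment against J_α: this gives the terms a_n. The
same series with |θ_σ| sums, up to a constant, to a probability, so convergence is absolute and the
interchange is legitimate (`vgLaw_real_Ioi_zero`).

Over (0, x], expand J_α as well. For non-integer a, J_a is a power series plus x^a times another
(`besselInt_eq`). Multiplying by the exponential series and integrating gives the terms -b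
(`hasSum_doubleTerm`). Then P(Y > x) = P(Y > 0) - P(0 < Y ≤ x) is the out-of-the-money formula, and
the reflection y ↦ -y, which turns θ into -θ, gives the in-the-money one.

The expansion of J_a rests on two identities: J_{-a}(x) = x^(-a) J_a(x), and ∫₀^x J_{a-1} = Γ(a) -
J_a(x) for a > 0. Together they express J_a through J_{1-a}. For 0 < a < 1, going from a to 1-a and
back produces new terms of the expansion and an error with a factorial in the denominator. A
three-term recurrence, shared by J and the series, reaches the other non-integer orders. -/

noncomputable section

namespace VarianceGamma

open Set Filter Topology

/-! ### The Bessel integral: integrability, reflection, recurrence, Volterra identity. -/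

/-- The integrand of the modified Bessel integral. -/
def besselKernel (a x v : ℝ) : ℝ := v ^ (a - 1) * Real.exp (-(x / v + v))

/-- The modified Bessel integral `∫₀^∞ v^(a-1) exp (-x/v - v) dv`. -/
def besselInt (a x : ℝ) : ℝ := ∫ v in Ioi (0 : ℝ), besselKernel a x v

/-- Coefficients of the two power series making up `besselInt`. -/
def besselCoeff (a : ℝ) (n : ℕ) : ℝ := (-1) ^ n / (n.factorial : ℝ) * Real.Gamma (a - n)

/-- The entire function `∑ besselCoeff a n * x ^ n`. -/
def besselSeries (a x : ℝ) : ℝ := ∑' n : ℕ, besselCoeff a n * x ^ n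

theorem besselKernel_nonneg (a x : ℝ) {v : ℝ} (hv : 0 ≤ v) : 0 ≤ besselKernel a x v :=
  mul_nonneg (Real.rpow_nonneg hv _) (Real.exp_pos _).le

theorem measurable_besselKernel (a : ℝ) :
    Measurable (fun p : ℝ × ℝ => besselKernel a p.1 p.2) := by
  unfold besselKernel; fun_prop

/-- Trades the decay at v = 0 for an arbitrary power of v, so that a kernel of any real order a is
dominated by a Gamma integrand once a + N > 0. -/
theorem exp_neg_div_le {x v : ℝ} (hx : 0 < x) (hv : 0 < v) (N : ℕ) :
    Real.exp (-(x / v)) ≤ N.factorial / x ^ N * v ^ N := by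
  have h := Real.pow_div_factorial_le_exp (x / v) (by positivity) N
  rw [Real.exp_neg, inv_le_comm₀ (Real.exp_pos _) (by positivity)]
  refine le_trans (le_of_eq ?_) h
  rw [div_pow]
  field_simp

theorem besselKernel_le {x v : ℝ} (a : ℝ) (hx : 0 < x) (hv : 0 < v) (N : ℕ) :
    besselKernel a x v ≤ N.factorial / x ^ N * (Real.exp (-v) * v ^ (a + N - 1)) := by
  unfold besselKernel
  rw [neg_add, Real.exp_add, show a + N - 1 = (a - 1) + N by ring, Real.rpow_add hv,
    Real.rpow_natCast]
  have h := exp_neg_div_le hx hv N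
  have h1 : 0 ≤ v ^ (a - 1) * Real.exp (-v) := by positivity
  nlinarith [mul_le_mul_of_nonneg_left h h1]

theorem besselKernel_le_gamma {x v : ℝ} (a : ℝ) (hx : 0 ≤ x) (hv : 0 < v) :
    besselKernel a x v ≤ Real.exp (-v) * v ^ (a - 1) := by
  unfold besselKernel
  rw [mul_comm]
  refine mul_le_mul_of_nonneg_right (Real.exp_le_exp.2 ?_) (Real.rpow_nonneg hv.le _)
  have : 0 ≤ x / v := by positivity
  linarith

theorem aestronglyMeasurable_besselKernel (a x : ℝ) (μ : Measure ℝ) :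
    AEStronglyMeasurable (besselKernel a x) μ :=
  ((measurable_besselKernel a).comp measurable_prodMk_left).aestronglyMeasurable

theorem integrableOn_besselKernel (a : ℝ) {x : ℝ} (hx : 0 < x) :
    IntegrableOn (besselKernel a x) (Ioi 0) := by
  obtain ⟨N, hN⟩ := exists_nat_gt (-a)
  have h := (Real.GammaIntegral_convergent (s := a + N) (by linarith)).const_mul
    ((N.factorial : ℝ) / x ^ N)
  refine Integrable.mono' h (aestronglyMeasurable_besselKernel _ _ _) ?_
  filter_upwards [ae_restrict_mem measurableSet_Ioi] with v hv
  rw [Real.norm_of_nonneg (besselKernel_nonneg a x (mem_Ioi.1 hv).le)]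
  exact besselKernel_le a hx hv N

theorem besselInt_nonneg (a x : ℝ) : 0 ≤ besselInt a x :=
  setIntegral_nonneg measurableSet_Ioi fun _ hv => besselKernel_nonneg a x (mem_Ioi.1 hv).le

theorem besselInt_le_Gamma {a x : ℝ} (ha : 0 < a) (hx : 0 < x) :
    besselInt a x ≤ Real.Gamma a := by
  rw [Real.Gamma_eq_integral ha]
  exact setIntegral_mono_on (integrableOn_besselKernel a hx) (Real.GammaIntegral_convergent ha)
    measurableSet_Ioi fun v hv => besselKernel_le_gamma a hx.le hv

/-- The substitution v = x/u exchanges the two summands of the exponent x/v + v. -/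
theorem besselInt_neg (a : ℝ) {x : ℝ} (hx : 0 < x) :
    besselInt (-a) x = x ^ (-a) * besselInt a x := by
  have h1 := integral_comp_rpow_Ioi (fun y => besselKernel (-a) x (x * y))
    (p := -1) (by norm_num)
  rw [integral_comp_mul_left_Ioi (fun y => besselKernel (-a) x y) 0 hx] at h1
  have h2 : ∫ u in Ioi (0 : ℝ), (|(-1 : ℝ)| * u ^ ((-1 : ℝ) - 1)) •
      besselKernel (-a) x (x * u ^ (-1 : ℝ)) = x ^ (-a - 1) * besselInt a x := by
    unfold besselInt
    rw [← integral_const_mul]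
    refine setIntegral_congr_fun measurableSet_Ioi fun u hu => ?_
    have hu : 0 < u := hu
    simp only [besselKernel, smul_eq_mul, abs_neg, abs_one, one_mul]
    rw [Real.mul_rpow hx.le (by positivity), ← Real.rpow_mul hu.le]
    have e : x / (x * u ^ (-1 : ℝ)) + x * u ^ (-1 : ℝ) = x / u + u := by
      rw [Real.rpow_neg_one]; field_simp; ring
    have e2 : u ^ (a - 1) = u ^ ((-1 : ℝ) - 1) * u ^ (-1 * (-a - 1)) := by
      rw [← Real.rpow_add hu]; congr 1; ring
    rw [e, e2]; ring
  rw [h2, mul_zero, smul_eq_mul, Real.rpow_sub hx, Real.rpow_one] at h1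
  unfold besselInt at h1 ⊢
  field_simp at h1
  linarith

theorem hasDerivAt_besselKernel (a x : ℝ) {v : ℝ} (hv : 0 < v) :
    HasDerivAt (besselKernel (a + 1) x)
      (a * besselKernel a x v + x * besselKernel (a - 1) x v - besselKernel (a + 1) x v) v := by
  have h1 : HasDerivAt (fun v : ℝ => v ^ (a + 1 - 1)) ((a + 1 - 1) * v ^ (a + 1 - 1 - 1)) v :=
    Real.hasDerivAt_rpow_const (Or.inl hv.ne')
  have h3 : HasDerivAt (fun v : ℝ => -(x / v + v)) (x / v ^ 2 - 1) v := by
    refine HasDerivAt.congr_deriv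
      (((hasDerivAt_inv hv.ne').const_mul x).add (hasDerivAt_id v)).neg ?_
    ring
  refine (h1.mul h3.exp).congr_deriv ?_
  have e1 : v ^ (a + 1 - 1) = v ^ (a - 1 - 1) * v ^ 2 := by
    rw [← Real.rpow_add_natCast hv.ne']; congr 1; push_cast; ring
  have e2 : v ^ (a - 1) = v ^ (a - 1 - 1) * v := by
    rw [← Real.rpow_add_one hv.ne']; congr 1; ring
  have e3 : v ^ (a + 1 - 1 - 1) = v ^ (a - 1 - 1) * v := by
    rw [← Real.rpow_add_one hv.ne']; congr 1; ring
  simp only [besselKernel]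
  rw [e3, e1, e2]
  field_simp
  ring

/-- The derivative of v^a exp(-x/v - v) integrates to zero over (0, ∞), as both boundary limits
vanish. -/
theorem besselInt_add_one {a : ℝ} (ha : a ≠ 0) {x : ℝ} (hx : 0 < x) :
    besselInt (a + 1) x = a * besselInt a x + x * besselInt (a - 1) x := by
  have i1 := (integrableOn_besselKernel a hx).const_mul a
  have i2 := (integrableOn_besselKernel (a - 1) hx).const_mul x
  have i3 := integrableOn_besselKernel (a + 1) hx
  have hbot : Tendsto (besselKernel (a + 1) x) (𝓝[>] 0) (𝓝 0) := by
    obtain ⟨N, hN⟩ := exists_nat_gt (-a)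
    have hc : Tendsto (fun v : ℝ => (N.factorial : ℝ) / x ^ N *
        (Real.exp (-v) * v ^ (a + 1 + N - 1))) (𝓝[>] 0) (𝓝 0) := by
      have : Tendsto (fun v : ℝ => (N.factorial : ℝ) / x ^ N *
        (Real.exp (-v) * v ^ (a + 1 + N - 1))) (𝓝 0)
        (𝓝 ((N.factorial : ℝ) / x ^ N * (Real.exp (-0) * 0 ^ (a + 1 + N - 1)))) := by
        refine Tendsto.const_mul _ (Tendsto.mul (by fun_prop : Continuous _).continuousAt.tendsto ?_)
        exact (Real.continuousAt_rpow_const _ _ (Or.inr (by linarith))).tendsto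
      rw [Real.zero_rpow (by linarith), mul_zero, mul_zero] at this
      exact this.mono_left nhdsWithin_le_nhds
    refine squeeze_zero' ?_ ?_ hc
    · filter_upwards [self_mem_nhdsWithin] with v hv
      exact besselKernel_nonneg _ _ (le_of_lt hv)
    · filter_upwards [self_mem_nhdsWithin] with v hv
      exact besselKernel_le _ hx hv N
  have htop : Tendsto (besselKernel (a + 1) x) atTop (𝓝 0) := by
    have hc := tendsto_rpow_mul_exp_neg_mul_atTop_nhds_zero a 1 one_pos
    refine squeeze_zero' ?_ ?_ hc
    · filter_upwards [eventually_gt_atTop 0] with v hv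
      exact besselKernel_nonneg _ _ (le_of_lt hv)
    · filter_upwards [eventually_gt_atTop 0] with v hv
      refine (besselKernel_le_gamma _ hx.le hv).trans (le_of_eq ?_)
      rw [add_sub_cancel_right, neg_one_mul, mul_comm]
  -- At v = 0 the division x/0 takes its default value and `0 ^ a` is 0 for every a ≠ 0, negative a
  -- included. This matches the limit from the right.
  have h0 : besselKernel (a + 1) x 0 = 0 := by
    unfold besselKernel
    rw [add_sub_cancel_right, Real.zero_rpow ha, zero_mul]
  have hcont : ContinuousWithinAt (besselKernel (a + 1) x) (Ici 0) 0 := by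
    rw [← continuousWithinAt_Ioi_iff_Ici, ContinuousWithinAt, h0]
    exact hbot
  have key := integral_Ioi_of_hasDerivAt_of_tendsto hcont
    (fun v hv => hasDerivAt_besselKernel a x hv) ((i1.add i2).sub i3) htop
  rw [h0] at key
  have e : ∫ v in Ioi (0 : ℝ), (a * besselKernel a x v + x * besselKernel (a - 1) x v
      - besselKernel (a + 1) x v) = a * besselInt a x + x * besselInt (a - 1) x
      - besselInt (a + 1) x := by
    unfold besselInt
    rw [← integral_const_mul, ← integral_const_mul, ← integral_add i1 i2]
    exact integral_sub (i1.add i2) i3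
  rw [e] at key
  linarith

/-- Differentiating the kernel in x lowers the order by one and changes the sign; Fubini then
integrates in s first, and a > 0 makes the value at s = 0 the Gamma integral. -/
theorem besselInt_volterra {a x : ℝ} (ha : 0 < a) (hx : 0 < x) :
    IntervalIntegrable (besselInt (a - 1)) volume 0 x ∧
      ∫ s in (0 : ℝ)..x, besselInt (a - 1) s = Real.Gamma a - besselInt a x := by
  have hinner : ∀ v : ℝ, 0 < v → ∫ s in Ioc 0 x, besselKernel (a - 1) s v
      = Real.exp (-v) * v ^ (a - 1) - besselKernel a x v := by
    intro v hv
    have hd : ∀ s ∈ uIcc 0 x, HasDerivAt (fun s => -besselKernel a s v)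
        (besselKernel (a - 1) s v) s := by
      intro s _
      have h3 : HasDerivAt (fun s : ℝ => -(s / v + v)) (-(1 / v)) s :=
        (((hasDerivAt_id s).div_const v).add_const v).neg
      refine ((h3.exp.const_mul (v ^ (a - 1))).neg).congr_deriv ?_
      unfold besselKernel
      rw [Real.rpow_sub_one hv.ne' (a - 1)]
      ring
    rw [← intervalIntegral.integral_of_le hx.le,
      intervalIntegral.integral_eq_sub_of_hasDerivAt hd]
    · simp only [besselKernel]
      rw [zero_div, zero_add]
      ring
    · apply Continuous.intervalIntegrable
      unfold besselKernel
      fun_prop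
  have hi : Integrable (fun p : ℝ × ℝ => besselKernel (a - 1) p.1 p.2)
      ((volume.restrict (Ioc 0 x)).prod (volume.restrict (Ioi 0))) := by
    rw [integrable_prod_iff' (measurable_besselKernel _).aestronglyMeasurable]
    constructor
    · filter_upwards with v
      have : Continuous fun s => besselKernel (a - 1) s v := by
        unfold besselKernel
        fun_prop
      exact (this.integrableOn_Icc (a := 0) (b := x)).mono_set Ioc_subset_Icc_self
    · refine ((Real.GammaIntegral_convergent ha).sub
        (integrableOn_besselKernel a hx)).congr ?_
      filter_upwards [ae_restrict_mem measurableSet_Ioi] with v hv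
      rw [Pi.sub_apply, ← hinner v hv]
      refine setIntegral_congr_fun measurableSet_Ioc fun s _ => ?_
      exact (Real.norm_of_nonneg (besselKernel_nonneg _ _ (le_of_lt hv))).symm
  constructor
  · rw [intervalIntegrable_iff_integrableOn_Ioc_of_le hx.le]
    exact hi.integral_prod_left
  · rw [intervalIntegral.integral_of_le hx.le]
    unfold besselInt
    rw [integral_integral_swap (f := fun s v => besselKernel (a - 1) s v) hi,
      setIntegral_congr_fun measurableSet_Ioi fun v hv => hinner v hv,
      integral_sub (Real.GammaIntegral_convergent ha) (integrableOn_besselKernel a hx),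
      Real.Gamma_eq_integral ha]

/-! ### The two power series and their recurrence. -/

theorem besselCoeff_zero (a : ℝ) : besselCoeff a 0 = Real.Gamma a := by
  simp [besselCoeff]

theorem besselCoeff_succ (a : ℝ) (n : ℕ) :
    besselCoeff (a - 1) n = -((n + 1) * besselCoeff a (n + 1)) := by
  unfold besselCoeff
  rw [Nat.factorial_succ, pow_succ, show a - 1 - (n : ℝ) = a - ((n + 1 : ℕ) : ℝ) by push_cast; ring]
  push_cast
  field_simp

theorem besselCoeff_add_one (a : ℝ) (n : ℕ) (h : a ≠ n) :
    besselCoeff (a + 1) n = (a - n) * besselCoeff a n := by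
  unfold besselCoeff
  rw [show a + 1 - (n : ℝ) = (a - n) + 1 by ring, Real.Gamma_add_one (sub_ne_zero.2 h)]
  ring

/-- Ratio test: Γ(s+1) = sΓ(s) gives c_n = -(a-n-1)(n+1) c_{n+1}, so the ratio is at most 1/2 once n
> a + 2|x|. -/
theorem summable_norm_besselCoeff (a x : ℝ) (ha : ∀ n : ℕ, a ≠ n) :
    Summable fun n => ‖besselCoeff a n * x ^ n‖ := by
  refine summable_of_ratio_norm_eventually_le (r := 1 / 2) (by norm_num) ?_
  obtain ⟨N, hN⟩ := exists_nat_gt (a + 2 * |x|)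
  filter_upwards [eventually_ge_atTop N] with n hn
  have hn' : (N : ℝ) ≤ n := by exact_mod_cast hn
  rw [norm_norm, norm_norm]
  have h2 : besselCoeff a n = -((a - n - 1) * (n + 1) * besselCoeff a (n + 1)) := by
    have := besselCoeff_add_one (a - 1) n (fun h => ha (n + 1) (by push_cast; linarith))
    rw [sub_add_cancel, besselCoeff_succ] at this
    rw [this]; ring
  rw [h2, pow_succ]
  simp only [norm_mul, norm_neg, Real.norm_eq_abs]
  have h3 : 2 * |x| ≤ |a - n - 1| := by
    have := abs_nonneg x
    rw [abs_of_neg (by linarith : a - n - 1 < 0)]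
    linarith
  have h4 : (1 : ℝ) ≤ |(n : ℝ) + 1| := by
    rw [abs_of_pos (by positivity)]; linarith [(Nat.cast_nonneg n : (0 : ℝ) ≤ n)]
  have h5 : 2 * |x| ≤ |a - n - 1| * |(n : ℝ) + 1| := by nlinarith [abs_nonneg (a - n - 1)]
  have h6 : 0 ≤ |besselCoeff a (n + 1)| * |x ^ n| := by positivity
  nlinarith [mul_le_mul_of_nonneg_left h5 h6]

theorem summable_besselCoeff (a x : ℝ) (ha : ∀ n : ℕ, a ≠ n) :
    Summable fun n => besselCoeff a n * x ^ n := (summable_norm_besselCoeff a x ha).of_norm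

/-- The series obeys the same recurrence as `besselInt`, coefficient by coefficient; this is what
carries the expansion from one order to the next. -/
theorem besselSeries_add_one (a x : ℝ) (ha : ∀ m : ℤ, a ≠ m) :
    besselSeries (a + 1) x = a * besselSeries a x + x * besselSeries (a - 1) x := by
  have n0 : ∀ n : ℕ, a ≠ n := fun n => by exact_mod_cast ha n
  have n1 : ∀ n : ℕ, a + 1 ≠ n := fun n h => ha (n - 1) (by push_cast; linarith)
  have n2 : ∀ n : ℕ, a - 1 ≠ n := fun n h => ha (n + 1) (by push_cast; linarith)
  have s0 := summable_besselCoeff a x n0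
  have s2 := summable_besselCoeff (a - 1) x n2
  unfold besselSeries
  rw [(summable_besselCoeff (a + 1) x n1).tsum_eq_zero_add, s0.tsum_eq_zero_add, mul_add,
    add_assoc, ← tsum_mul_left, ← tsum_mul_left,
    ← (((summable_nat_add_iff 1).2 s0).mul_left a).tsum_add (s2.mul_left x)]
  congr 1
  · rw [besselCoeff_add_one a 0 (by simpa using n0 0)]
    push_cast
    ring
  · refine tsum_congr fun n => ?_
    rw [besselCoeff_add_one a (n + 1) (n0 (n + 1)), besselCoeff_succ]
    push_cast
    ring

/-! ### Volterra iteration and the expansion at non-integer order. -/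

/-- Partial sums of the expansion of `besselInt a` about `0`. -/
def besselPartial (a : ℝ) (N M : ℕ) (x : ℝ) : ℝ :=
  (∑ n ∈ Finset.range N, besselCoeff a n * x ^ n)
    + ∑ n ∈ Finset.range M, besselCoeff (-a) n * x ^ ((n : ℝ) + a)

/-- Integration exchanges the roles of the two sums and contributes the constant Γ(a), hence the
lengths (N, M) become (M + 1, N). -/
theorem besselPartial_volterra {a x : ℝ} (ha : 0 < a) (hx : 0 < x)
    (hai : ∀ m : ℤ, a ≠ m) (N M : ℕ) :
    IntervalIntegrable (fun s => s ^ (a - 1) * besselPartial (1 - a) N M s) volume 0 x ∧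
      ∫ s in (0 : ℝ)..x, s ^ (a - 1) * besselPartial (1 - a) N M s
        = Real.Gamma a - besselPartial a (M + 1) N x := by
  have i1 : ∀ n : ℕ, IntervalIntegrable
      (fun s : ℝ => besselCoeff (1 - a) n * s ^ ((n : ℝ) + a - 1)) volume 0 x := fun n =>
    (intervalIntegral.intervalIntegrable_rpow'
      (by linarith [(Nat.cast_nonneg n : (0 : ℝ) ≤ n)])).const_mul _
  have i2 : ∀ n : ℕ, IntervalIntegrable
      (fun s : ℝ => besselCoeff (a - 1) n * s ^ n) volume 0 x := fun n =>
    (intervalIntegral.intervalIntegrable_pow n).const_mul _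
  have e : ∀ s ∈ uIoc 0 x, (∑ n ∈ Finset.range N, besselCoeff (1 - a) n * s ^ ((n : ℝ) + a - 1))
      + (∑ n ∈ Finset.range M, besselCoeff (a - 1) n * s ^ n)
      = s ^ (a - 1) * besselPartial (1 - a) N M s := by
    intro s hs
    rw [uIoc_of_le hx.le] at hs
    have hs : 0 < s := hs.1
    unfold besselPartial
    rw [mul_add, Finset.mul_sum, Finset.mul_sum]
    congr 1
    · refine Finset.sum_congr rfl fun n _ => ?_
      rw [show (n : ℝ) + a - 1 = (a - 1) + n by ring, Real.rpow_add hs, Real.rpow_natCast]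
      ring
    · refine Finset.sum_congr rfl fun n _ => ?_
      rw [neg_sub, ← Real.rpow_natCast, show (n : ℝ) = (a - 1) + (n + (1 - a)) by ring,
        Real.rpow_add hs, show (a - 1) + (n + (1 - a)) = (n : ℝ) by ring]
      ring
  have j1 : IntervalIntegrable (fun s => ∑ n ∈ Finset.range N,
      besselCoeff (1 - a) n * s ^ ((n : ℝ) + a - 1)) volume 0 x := by
    simpa only [Finset.sum_fn] using IntervalIntegrable.sum (Finset.range N) fun n _ => i1 n
  have j2 : IntervalIntegrable (fun s => ∑ n ∈ Finset.range M,
      besselCoeff (a - 1) n * s ^ n) volume 0 x := by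
    simpa only [Finset.sum_fn] using IntervalIntegrable.sum (Finset.range M) fun n _ => i2 n
  refine ⟨(j1.add j2).congr e, ?_⟩
  rw [← intervalIntegral.integral_congr_ae (Eventually.of_forall e),
    intervalIntegral.integral_add j1 j2,
    intervalIntegral.integral_finsetSum fun n _ => i1 n,
    intervalIntegral.integral_finsetSum fun n _ => i2 n]
  have e1 : ∀ n : ℕ, ∫ s in (0 : ℝ)..x, besselCoeff (1 - a) n * s ^ ((n : ℝ) + a - 1)
      = -(besselCoeff (-a) n * x ^ ((n : ℝ) + a)) := by
    intro n
    have hn : (0 : ℝ) ≤ n := Nat.cast_nonneg n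
    rw [intervalIntegral.integral_const_mul, integral_rpow (Or.inl (by linarith)),
      sub_add_cancel, Real.zero_rpow (by linarith), sub_zero,
      show 1 - a = -a + 1 by ring, besselCoeff_add_one (-a) n
        (fun h => hai (-n) (by push_cast; linarith))]
    have : (n : ℝ) + a ≠ 0 := by linarith
    field_simp
    ring
  have e2 : ∀ n : ℕ, ∫ s in (0 : ℝ)..x, besselCoeff (a - 1) n * s ^ n
      = -(besselCoeff a (n + 1) * x ^ (n + 1)) := by
    intro n
    rw [intervalIntegral.integral_const_mul, integral_pow, zero_pow (by omega), sub_zero,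
      besselCoeff_succ]
    have : (n : ℝ) + 1 ≠ 0 := by positivity
    field_simp
  simp only [e1, e2]
  unfold besselPartial
  rw [Finset.sum_range_succ', besselCoeff_zero]
  simp only [Finset.sum_neg_distrib]
  ring

/-- By reflection `besselInt (a - 1) s` is s^(a-1) `besselInt (1 - a) s`, so subtracting the two
Volterra identities cancels Γ(a) and leaves the integral of the previous error times s^(a-1). -/
theorem besselInt_sub_partial_volterra {a x : ℝ} (ha : 0 < a) (hx : 0 < x)
    (hai : ∀ m : ℤ, a ≠ m) (N M : ℕ) {B p : ℝ} (hp : 0 < p + a)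
    (hB : ∀ s, 0 < s → |besselInt (1 - a) s - besselPartial (1 - a) N M s| ≤ B * s ^ p) :
    |besselInt a x - besselPartial a (M + 1) N x| ≤ B / (p + a) * x ^ (p + a) := by
  obtain ⟨i1, e1⟩ := besselInt_volterra ha hx
  obtain ⟨i2, e2⟩ := besselPartial_volterra ha hx hai N M
  have h := intervalIntegral.norm_integral_le_of_norm_le hx.le
    (f := fun s => besselInt (a - 1) s - s ^ (a - 1) * besselPartial (1 - a) N M s)
    (g := fun s => B * s ^ (p + a - 1)) (μ := volume)
    (Eventually.of_forall fun s hs => ?_)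
    ((intervalIntegral.intervalIntegrable_rpow' (by linarith)).const_mul _)
  · rw [intervalIntegral.integral_sub i1 i2, e1, e2, intervalIntegral.integral_const_mul,
      integral_rpow (Or.inl (by linarith)), sub_add_cancel, Real.zero_rpow hp.ne', sub_zero,
      Real.norm_eq_abs, abs_sub_comm] at h
    calc _ = _ := by congr 1; ring
      _ ≤ _ := h
      _ = _ := by ring
  · have hs : 0 < s := hs.1
    rw [show a - 1 = -(1 - a) by ring, besselInt_neg _ hs, ← mul_sub, norm_mul,
      Real.norm_of_nonneg (by positivity), show p + a - 1 = p + -(1 - a) by ring,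
      Real.rpow_add hs]
    have := mul_le_mul_of_nonneg_left (hB s hs) (Real.rpow_nonneg hs.le (-(1 - a)))
    rw [Real.norm_eq_abs]
    linarith

/-- Each induction step passes a → 1-a → a: the lengths go (N, N) → (N+1, N) → (N+1, N+1), and the
error gains the factor x/((N+1-a)(N+1)). -/
theorem abs_besselInt_sub_partial_le {a : ℝ} (h0 : 0 < a) (h1 : a < 1)
    (hai : ∀ m : ℤ, a ≠ m) (N : ℕ) :
    ∀ x, 0 < x → |besselInt a x - besselPartial a N N x|
      ≤ Real.Gamma a * (1 / (1 - a)) ^ N / N.factorial * x ^ (N : ℝ) := by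
  induction N with
  | zero =>
    intro x hx
    simpa [besselPartial, abs_of_nonneg (besselInt_nonneg a x)] using besselInt_le_Gamma h0 hx
  | succ N ih =>
    intro x hx
    have hbi : ∀ m : ℤ, 1 - a ≠ m := fun m h => hai (1 - m) (by push_cast; linarith)
    have hN : (0 : ℝ) ≤ N := Nat.cast_nonneg N
    set B := Real.Gamma a * (1 / (1 - a)) ^ N / N.factorial with hBdef
    have hB : 0 ≤ B := by
      have : 0 < 1 - a := by linarith
      have := Real.Gamma_pos_of_pos h0
      positivity
    have step1 : ∀ s, 0 < s → |besselInt (1 - a) s - besselPartial (1 - a) (N + 1) N s|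
        ≤ B / (N + (1 - a)) * s ^ (N + (1 - a)) := fun s hs =>
      besselInt_sub_partial_volterra (by linarith) hs hbi N N (by linarith)
        (by simpa only [sub_sub_cancel] using ih)
    have step2 := besselInt_sub_partial_volterra h0 hx hai (N + 1) N (by linarith) step1
    refine step2.trans ?_
    rw [show (N : ℝ) + (1 - a) + a = N + 1 by ring, Nat.factorial_succ]
    push_cast
    refine mul_le_mul_of_nonneg_right ?_ (by positivity)
    have e : Real.Gamma a * (1 / (1 - a)) ^ (N + 1) / ((N + 1) * N.factorial)
        = B / (1 - a) / (N + 1) := by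
      rw [hBdef, pow_succ]
      have : (1 - a) ≠ 0 := by linarith
      field_simp
    -- Only N + (1 - a) ≥ 1 - a is used; the other denominator N + 1 already supplies the factorial.
    rw [e]
    gcongr
    linarith

theorem besselInt_eq_of_mem_Ioo {a x : ℝ} (h0 : 0 < a) (h1 : a < 1) (hx : 0 < x) :
    besselInt a x = besselSeries a x + x ^ a * besselSeries (-a) x := by
  have hai : ∀ m : ℤ, a ≠ m := by
    rintro m rfl
    have h0 : 0 < m := by exact_mod_cast h0
    have h1 : m < 1 := by exact_mod_cast h1
    omega
  have l1 := (summable_besselCoeff a x fun n => by exact_mod_cast hai n).hasSum.tendsto_sum_nat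
  have l2 := (summable_besselCoeff (-a) x fun n h =>
    hai (-n) (by push_cast; linarith)).hasSum.tendsto_sum_nat
  have l3 : Tendsto (fun N => besselPartial a N N x) atTop
      (𝓝 (besselSeries a x + x ^ a * besselSeries (-a) x)) := by
    refine (l1.add (l2.const_mul (x ^ a))).congr fun N => ?_
    unfold besselPartial
    rw [Finset.mul_sum]
    congr 1
    refine Finset.sum_congr rfl fun n _ => ?_
    rw [Real.rpow_add hx, Real.rpow_natCast]
    ring
  refine tendsto_nhds_unique ?_ l3
  rw [tendsto_iff_norm_sub_tendsto_zero]
  have l4 := (FloorSemiring.tendsto_pow_div_factorial_atTop (1 / (1 - a) * x)).const_mul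
    (Real.Gamma a)
  rw [mul_zero] at l4
  refine squeeze_zero (fun _ => norm_nonneg _) (fun N => ?_) l4
  rw [norm_sub_rev, Real.norm_eq_abs]
  refine (abs_besselInt_sub_partial_le h0 h1 hai N x hx).trans (le_of_eq ?_)
  rw [Real.rpow_natCast, mul_pow]
  ring

theorem besselInt_eq_neg {a x : ℝ} (hx : 0 < x)
    (h : besselInt a x = besselSeries a x + x ^ a * besselSeries (-a) x) :
    besselInt (-a) x = besselSeries (-a) x + x ^ (-a) * besselSeries (- -a) x := by
  rw [besselInt_neg a hx, h, mul_add, ← mul_assoc, ← Real.rpow_add hx, neg_neg, neg_add_cancel,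
    Real.rpow_zero]
  ring

/-- Two consecutive orders are carried because the recurrence has three terms; the base order a - 1
is the reflection of 1 - a ∈ (0, 1). -/
theorem besselInt_eq_nat_add {a x : ℝ} (h0 : 0 < a) (h1 : a < 1) (hx : 0 < x) (n : ℕ) :
    besselInt (a + n) x = besselSeries (a + n) x + x ^ (a + n) * besselSeries (-(a + n)) x ∧
    besselInt (a + n - 1) x = besselSeries (a + n - 1) x
      + x ^ (a + n - 1) * besselSeries (-(a + n - 1)) x := by
  induction n with
  | zero =>
    have := besselInt_eq_neg hx (besselInt_eq_of_mem_Ioo (a := 1 - a) (by linarith)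
      (by linarith) hx)
    simp only [Nat.cast_zero, add_zero]
    exact ⟨besselInt_eq_of_mem_Ioo h0 h1 hx, by rwa [neg_sub] at this⟩
  | succ n ih =>
    have hai : ∀ m : ℤ, a + n ≠ m := by
      intro m h
      have g0 : (n : ℝ) < m := by linarith
      have g1 : (m : ℝ) < n + 1 := by linarith
      have g0 : (n : ℤ) < m := by exact_mod_cast g0
      have g1 : m < (n : ℤ) + 1 := by exact_mod_cast g1
      omega
    have hbi : ∀ m : ℤ, -(a + n) ≠ m := fun m h => hai (-m) (by push_cast; linarith)
    push_cast
    rw [← add_assoc, add_sub_cancel_right]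
    refine ⟨?_, ih.1⟩
    rw [besselInt_add_one (by positivity) hx, ih.1, ih.2, besselSeries_add_one _ _ hai]
    -- The second series has the opposite order, so its recurrence is taken at -(a + n) and runs the
    -- other way.
    have k := besselSeries_add_one _ x hbi
    rw [show -(a + n) + 1 = -(a + n - 1) by ring, show -(a + n) - 1 = -(a + n + 1) by ring] at k
    rw [k, Real.rpow_add_one hx.ne', Real.rpow_sub_one hx.ne']
    field_simp
    ring

/-- Expansion of the modified Bessel integral of non-integer order. -/
theorem besselInt_eq {a x : ℝ} (hai : ∀ m : ℤ, a ≠ m) (hx : 0 < x) :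
    besselInt a x = besselSeries a x + x ^ a * besselSeries (-a) x := by
  have pos : ∀ b : ℝ, 0 < b → (∀ m : ℤ, b ≠ m) →
      besselInt b x = besselSeries b x + x ^ b * besselSeries (-b) x := by
    intro b hb hbi
    have h := (besselInt_eq_nat_add (a := Int.fract b) (x := x)
      (lt_of_le_of_ne (Int.fract_nonneg b) fun h => hbi ⌊b⌋ (by
        have := Int.fract_add_floor b; linarith))
      (Int.fract_lt_one b) hx ⌊b⌋.toNat).1
    have e : ((⌊b⌋.toNat : ℕ) : ℝ) = (⌊b⌋ : ℝ) := by
      exact_mod_cast Int.toNat_of_nonneg (Int.floor_nonneg.2 hb.le)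
    rwa [e, Int.fract_add_floor] at h
  rcases lt_trichotomy a 0 with h | h | h
  · have := besselInt_eq_neg hx (pos (-a) (by linarith)
      fun m h => hai (-m) (by push_cast; linarith))
    rwa [neg_neg] at this
  · exact absurd h (by simpa using hai 0)
  · exact pos a h hai

/-! ### The density of the Variance Gamma law. -/

theorem qPar_pos {σ ν : ℝ} (θ : ℝ) (hσ : 0 < σ) (hν : 0 < ν) : 0 < qPar σ ν θ := by
  unfold qPar; positivity

theorem qPar_neg (σ ν θ : ℝ) : qPar σ ν (-θ) = qPar σ ν θ := by
  unfold qPar; ring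

theorem qPar_abs (σ ν θ : ℝ) : qPar σ ν |θ| = qPar σ ν θ := by
  rcases abs_choice θ with h | h <;> rw [h]
  exact qPar_neg _ _ _

theorem thetaSigma_neg (σ θ : ℝ) : thetaSigma σ (-θ) = -thetaSigma σ θ := by
  unfold thetaSigma; ring

theorem thetaSigma_abs (σ θ : ℝ) : thetaSigma σ |θ| = |thetaSigma σ θ| := by
  unfold thetaSigma; rw [abs_div, abs_of_nonneg (sq_nonneg σ)]

theorem sigmaNu_pos {σ ν : ℝ} (hσ : 0 < σ) (hν : 0 < ν) : 0 < sigmaNu σ ν := by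
  unfold sigmaNu; positivity

theorem prefactor_eq_exp_mul (r τ ν sν : ℝ) :
    prefactor r τ ν sν = Real.exp (-r * τ) * prefactor 0 τ ν sν := by
  unfold prefactor
  rw [neg_zero, zero_mul, Real.exp_zero]
  ring

theorem prefactor_pos (r : ℝ) {τ ν sν : ℝ} (hτ : 0 < τ) (hν : 0 < ν) (hs : 0 < sν) :
    0 < prefactor r τ ν sν := by
  have := Real.Gamma_pos_of_pos (div_pos hτ hν)
  unfold prefactor
  positivity

/-- The Lebesgue density of the Variance Gamma law. -/
def vgDensity (σ ν θ t y : ℝ) : ℝ :=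
  2 * prefactor 0 t ν (sigmaNu σ ν) * qPar σ ν θ ^ (-alpha t ν)
    * (Real.exp (thetaSigma σ θ * y) * besselInt (alpha t ν) (qPar σ ν θ * y ^ 2))

theorem vgDensity_neg (σ ν θ t y : ℝ) : vgDensity σ ν (-θ) t y = vgDensity σ ν θ t (-y) := by
  unfold vgDensity
  rw [qPar_neg, thetaSigma_neg, neg_mul, neg_sq, mul_neg]

theorem vgDensity_nonneg {σ ν t : ℝ} (θ y : ℝ) (hσ : 0 < σ) (hν : 0 < ν) (ht : 0 < t) :
    0 ≤ vgDensity σ ν θ t y := by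
  have h1 := prefactor_pos 0 ht hν (sigmaNu_pos hσ hν)
  have h2 := qPar_pos θ hσ hν
  have h3 := besselInt_nonneg (alpha t ν) (qPar σ ν θ * y ^ 2)
  unfold vgDensity
  positivity

theorem two_mul_prefactor {σ ν t : ℝ} (hσ : 0 < σ) (hν : 0 < ν) :
    2 * prefactor 0 t ν (sigmaNu σ ν)
      = (1 / ν) ^ (t / ν) / Real.Gamma (t / ν) * (Real.sqrt (2 * Real.pi) * σ)⁻¹
        * (2 * σ ^ 2) ^ (-alpha t ν) := by
  have e1 : (2 : ℝ) ^ (2 + 2 * alpha t ν) = 2 * (2 ^ (t / ν) * 2 ^ (t / ν)) := by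
    unfold alpha
    rw [← Real.rpow_add two_pos, show 2 + 2 * (t / ν - 1 / 2) = 1 + (t / ν + t / ν) by ring,
      Real.rpow_add two_pos, Real.rpow_one]
  have e2 : sigmaNu σ ν ^ (1 + 2 * alpha t ν) = σ ^ (2 * (t / ν)) * (ν ^ (t / ν) / 2 ^ (t / ν)) := by
    unfold sigmaNu alpha
    rw [show 1 + 2 * (t / ν - 1 / 2) = 2 * (t / ν) by ring,
      Real.mul_rpow hσ.le (Real.sqrt_nonneg _), Real.sqrt_eq_rpow, ← Real.rpow_mul (by positivity),
      show 1 / 2 * (2 * (t / ν)) = t / ν by ring, Real.div_rpow hν.le zero_le_two]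
  have e3 : (2 * σ ^ 2) ^ (-alpha t ν)
      = Real.sqrt 2 / 2 ^ (t / ν) * (σ / σ ^ (2 * (t / ν))) := by
    unfold alpha
    rw [neg_sub, Real.mul_rpow zero_le_two (by positivity), Real.rpow_sub two_pos,
      ← Real.sqrt_eq_rpow, ← Real.rpow_natCast, ← Real.rpow_mul hσ.le,
      show ((2 : ℕ) : ℝ) * (1 / 2 - t / ν) = 1 - 2 * (t / ν) by push_cast; ring,
      Real.rpow_sub hσ, Real.rpow_one]
  unfold prefactor
  rw [e1, e2, e3, Real.div_rpow zero_le_one hν.le, Real.one_rpow, neg_zero, zero_mul,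
    Real.exp_zero, Real.sqrt_mul zero_le_two]
  have p1 : 0 < Real.sqrt 2 := by positivity
  have p2 : 0 < Real.sqrt Real.pi := Real.sqrt_pos.2 Real.pi_pos
  -- The sign of t is not assumed, so Γ(t/ν) may vanish; both sides are then 0 by division by zero.
  by_cases hG : Real.Gamma (t / ν) = 0
  · simp [hG]
  have p3 : 0 < (2 : ℝ) ^ (t / ν) := by positivity
  have p4 : 0 < ν ^ (t / ν) := by positivity
  have p5 : 0 < σ ^ (2 * (t / ν)) := by positivity
  generalize (2 : ℝ) ^ (t / ν) = A at *
  generalize ν ^ (t / ν) = B at *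
  generalize σ ^ (2 * (t / ν)) = C at *
  field_simp

/-- Completing the square works because 2σ²q = 1/ν + θ²/(2σ²). The factor g^(-1/2) of the Gaussian
density is what lowers the order from t/ν to α. -/
theorem gammaPDFReal_mul_gaussianPDFReal {σ ν g : ℝ} (θ t y : ℝ) (hσ : 0 < σ) (hν : 0 < ν)
    (hg : 0 < g) {V : ℝ≥0} (hV : (V : ℝ) = σ ^ 2 * g) :
    gammaPDFReal (t / ν) (1 / ν) g * gaussianPDFReal (θ * g) V y
      = 2 * prefactor 0 t ν (sigmaNu σ ν) * qPar σ ν θ ^ (-alpha t ν)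
        * Real.exp (thetaSigma σ θ * y) * (2 * σ ^ 2 * qPar σ ν θ)
        * besselKernel (alpha t ν) (qPar σ ν θ * y ^ 2) (2 * σ ^ 2 * qPar σ ν θ * g) := by
  have hq := qPar_pos θ hσ hν
  have hp : 0 < 2 * σ ^ 2 * qPar σ ν θ := by positivity
  rw [two_mul_prefactor hσ hν]
  unfold gammaPDFReal gaussianPDFReal besselKernel
  rw [if_pos hg.le, hV, Real.mul_rpow hp.le hg.le, Real.rpow_sub_one hp.ne',
    Real.mul_rpow (by positivity : (0 : ℝ) ≤ 2 * σ ^ 2) hq.le]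
  have e1 : Real.sqrt (2 * Real.pi * (σ ^ 2 * g)) = Real.sqrt (2 * Real.pi) * σ * g ^ (1 / 2 : ℝ) := by
    rw [Real.sqrt_mul (by positivity), Real.sqrt_mul (sq_nonneg σ), Real.sqrt_sq hσ.le,
      Real.sqrt_eq_rpow g]
    ring
  have e2 : g ^ (t / ν - 1) = g ^ (alpha t ν - 1) * g ^ (1 / 2 : ℝ) := by
    rw [← Real.rpow_add hg]; congr 1; unfold alpha; ring
  have e3 : Real.exp (-(1 / ν * g)) * Real.exp (-(y - θ * g) ^ 2 / (2 * (σ ^ 2 * g)))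
      = Real.exp (thetaSigma σ θ * y) * Real.exp (-(qPar σ ν θ * y ^ 2
        / (2 * σ ^ 2 * qPar σ ν θ * g) + 2 * σ ^ 2 * qPar σ ν θ * g)) := by
    rw [← Real.exp_add, ← Real.exp_add]
    congr 1
    rw [show qPar σ ν θ * y ^ 2 / (2 * σ ^ 2 * qPar σ ν θ * g) = y ^ 2 / (2 * σ ^ 2 * g) by
      field_simp]
    unfold thetaSigma qPar
    field_simp
    ring
  have hA : (2 * σ ^ 2) ^ (-alpha t ν) * (2 * σ ^ 2) ^ alpha t ν = 1 := by
    rw [← Real.rpow_add (by positivity), neg_add_cancel, Real.rpow_zero]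
  have hB : qPar σ ν θ ^ (-alpha t ν) * qPar σ ν θ ^ alpha t ν = 1 := by
    rw [← Real.rpow_add hq, neg_add_cancel, Real.rpow_zero]
  have hg2 : g ^ (1 / 2 : ℝ) * (g ^ (1 / 2 : ℝ))⁻¹ = 1 := mul_inv_cancel₀ (by positivity)
  rw [e1, e2, mul_inv]
  generalize g ^ (alpha t ν - 1) = G at *
  generalize g ^ (1 / 2 : ℝ) = H at *
  calc _ = (1 / ν) ^ (t / ν) / Real.Gamma (t / ν) * (Real.sqrt (2 * Real.pi) * σ)⁻¹ * G
        * (H * H⁻¹) * (Real.exp (-(1 / ν * g)) * Real.exp (-(y - θ * g) ^ 2 / (2 * (σ ^ 2 * g)))) := by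
        ring
    _ = (1 / ν) ^ (t / ν) / Real.Gamma (t / ν) * (Real.sqrt (2 * Real.pi) * σ)⁻¹ * G
        * ((2 * σ ^ 2) ^ (-alpha t ν) * (2 * σ ^ 2) ^ alpha t ν)
        * (qPar σ ν θ ^ (-alpha t ν) * qPar σ ν θ ^ alpha t ν)
        * (Real.exp (thetaSigma σ θ * y) * Real.exp (-(qPar σ ν θ * y ^ 2
        / (2 * σ ^ 2 * qPar σ ν θ * g) + 2 * σ ^ 2 * qPar σ ν θ * g))) := by
        rw [e3, hg2, hA, hB]; ring
    _ = _ := by field_simp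

theorem isProbabilityMeasure_vgLaw {σ ν t : ℝ} (θ : ℝ) (hν : 0 < ν) (ht : 0 < t) :
    IsProbabilityMeasure (vgLaw σ ν θ t) := by
  have := isProbabilityMeasure_gammaMeasure (div_pos ht hν) (one_div_pos.2 hν)
  exact Measure.isProbabilityMeasure_map (by fun_prop)

theorem lintegral_gammaPDF_mul_gaussianPDF {σ ν t : ℝ} (θ : ℝ) (hσ : 0 < σ) (hν : 0 < ν)
    (ht : 0 < t) {y : ℝ} (hy : y ≠ 0) :
    ∫⁻ g in Ioi (0 : ℝ), gammaPDF (t / ν) (1 / ν) g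
      * gaussianPDF (θ * g) (Real.toNNReal (σ ^ 2 * g)) y
      = ENNReal.ofReal (vgDensity σ ν θ t y) := by
  have hq := qPar_pos θ hσ hν
  have hp : 0 < 2 * σ ^ 2 * qPar σ ν θ := by positivity
  have hx : 0 < qPar σ ν θ * y ^ 2 := by positivity
  have hpt : ∀ g ∈ Ioi (0 : ℝ), gammaPDFReal (t / ν) (1 / ν) g
      * gaussianPDFReal (θ * g) (Real.toNNReal (σ ^ 2 * g)) y = _ := fun g (hg : 0 < g) =>
    gammaPDFReal_mul_gaussianPDFReal θ t y hσ hν hg (Real.coe_toNNReal _ (by positivity))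
  have hint := ((integrableOn_Ioi_comp_mul_left_iff
    (besselKernel (alpha t ν) (qPar σ ν θ * y ^ 2)) 0 hp).2
    (by rw [mul_zero]; exact integrableOn_besselKernel _ hx)).const_mul
    (2 * prefactor 0 t ν (sigmaNu σ ν) * qPar σ ν θ ^ (-alpha t ν)
        * Real.exp (thetaSigma σ θ * y) * (2 * σ ^ 2 * qPar σ ν θ))
  have hnn : ∀ g ∈ Ioi (0 : ℝ), 0 ≤ gammaPDFReal (t / ν) (1 / ν) g
      * gaussianPDFReal (θ * g) (Real.toNNReal (σ ^ 2 * g)) y := fun g _ =>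
    mul_nonneg (gammaPDFReal_nonneg (div_pos ht hν) (one_div_pos.2 hν) g)
      (gaussianPDFReal_nonneg _ _ _)
  calc _ = ∫⁻ g in Ioi (0 : ℝ), ENNReal.ofReal (2 * prefactor 0 t ν (sigmaNu σ ν)
        * qPar σ ν θ ^ (-alpha t ν) * Real.exp (thetaSigma σ θ * y) * (2 * σ ^ 2 * qPar σ ν θ)
        * besselKernel (alpha t ν) (qPar σ ν θ * y ^ 2) (2 * σ ^ 2 * qPar σ ν θ * g)) := by
        refine setLIntegral_congr_fun measurableSet_Ioi fun g hg => ?_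
        rw [← hpt g hg, gammaPDF, gaussianPDF, ENNReal.ofReal_mul' (gaussianPDFReal_nonneg _ _ _)]
    _ = _ := by
        rw [← ofReal_integral_eq_lintegral_ofReal hint, integral_const_mul,
          integral_comp_mul_left_Ioi _ _ hp, mul_zero, vgDensity, besselInt, smul_eq_mul]
        · congr 1
          field_simp
        · filter_upwards [ae_restrict_mem measurableSet_Ioi] with g hg
          rw [← hpt g hg]
          exact hnn g hg

/-- Conditioning on g gives a Gaussian mixture, and Tonelli integrates g out. The point y = 0, where
the Bessel integral may diverge, is null. -/
theorem vgLaw_apply {σ ν t : ℝ} (θ : ℝ) (hσ : 0 < σ) (hν : 0 < ν) (ht : 0 < t) {s : Set ℝ}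
    (hs : MeasurableSet s) :
    vgLaw σ ν θ t s = ∫⁻ y in s, ENNReal.ofReal (vgDensity σ ν θ t y) := by
  have hm1 : Measurable (gammaPDF (t / ν) (1 / ν)) := (measurable_gammaPDFReal _ _).ennreal_ofReal
  have hm2 : Measurable fun p : ℝ × ℝ =>
      gaussianPDF (θ * p.1) (Real.toNNReal (σ ^ 2 * p.1)) p.2 := by
    unfold gaussianPDF gaussianPDFReal
    fun_prop
  have hm : Measurable (fun p : ℝ × ℝ => θ * p.1 + σ * (Real.sqrt p.1 * p.2)) := by fun_prop
  unfold vgLaw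
  rw [Measure.map_apply hm hs, Measure.prod_apply (hm hs)]
  have hm3 : Measurable fun g => ∫⁻ y in s, gaussianPDF (θ * g) (Real.toNNReal (σ ^ 2 * g)) y :=
    hm2.lintegral_prod_right'
  have hg : ∀ g : ℝ, 0 < g → gaussianReal 0 1 (Prod.mk g ⁻¹'
      ((fun p : ℝ × ℝ => θ * p.1 + σ * (Real.sqrt p.1 * p.2)) ⁻¹' s))
      = ∫⁻ y in s, gaussianPDF (θ * g) (Real.toNNReal (σ ^ 2 * g)) y := by
    intro g hg
    have hV : Real.toNNReal (σ ^ 2 * g) ≠ 0 := by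
      have : 0 < σ ^ 2 * g := by positivity
      simpa using this
    have h1 := gaussianReal_map_const_mul (μ := 0) (v := 1) (σ * Real.sqrt g)
    have h2 : (gaussianReal 0 1).map (fun z => θ * g + σ * (Real.sqrt g * z))
        = gaussianReal (θ * g) (Real.toNNReal (σ ^ 2 * g)) := by
      have := gaussianReal_map_const_add (μ := 0) (v := Real.toNNReal (σ ^ 2 * g)) (θ * g)
      rw [zero_add] at this
      rw [← this]
      have e : gaussianReal 0 (Real.toNNReal (σ ^ 2 * g))
          = (gaussianReal 0 1).map fun z => σ * Real.sqrt g * z := by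
        rw [h1, mul_zero]
        congr 1
        ext
        rw [Real.coe_toNNReal _ (by positivity)]
        simp [mul_pow, Real.sq_sqrt hg.le]
      rw [e, Measure.map_map (by fun_prop) (by fun_prop)]
      congr 1
      ext z
      simp only [Function.comp]
      ring
    rw [← gaussianReal_apply _ hV, ← h2, Measure.map_apply (by fun_prop) hs]
    rfl
  -- Restricting to g > 0 keeps the Gaussian variance σ²g nonzero.
  have h0 : gammaMeasure (t / ν) (1 / ν)
      = (volume.restrict (Ioi 0)).withDensity (gammaPDF (t / ν) (1 / ν)) := by
    rw [← withDensity_indicator measurableSet_Ioi]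
    refine withDensity_congr_ae ?_
    filter_upwards [compl_mem_ae_iff.2 (measure_singleton (μ := volume) (0 : ℝ))] with g hg
    rcases lt_or_gt_of_ne (show g ≠ 0 from hg) with h | h
    · rw [indicator_of_notMem (by simpa using h.le), gammaPDF_of_neg h]
    · rw [indicator_of_mem (mem_Ioi.2 h)]
  rw [h0, lintegral_withDensity_eq_lintegral_mul _ hm1 (measurable_measure_prodMk_left (hm hs))]
  calc _ = ∫⁻ g in Ioi (0 : ℝ), ∫⁻ y in s, gammaPDF (t / ν) (1 / ν) g
        * gaussianPDF (θ * g) (Real.toNNReal (σ ^ 2 * g)) y := by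
        refine setLIntegral_congr_fun measurableSet_Ioi fun g hg' => ?_
        rw [Pi.mul_apply, hg g hg', lintegral_const_mul _ (by fun_prop)]
    _ = ∫⁻ y in s, ∫⁻ g in Ioi (0 : ℝ), gammaPDF (t / ν) (1 / ν) g
        * gaussianPDF (θ * g) (Real.toNNReal (σ ^ 2 * g)) y := by
        refine lintegral_lintegral_swap (Measurable.aemeasurable ?_)
        exact (hm1.comp measurable_fst).mul hm2
    _ = _ := by
        refine lintegral_congr_ae (ae_restrict_of_ae ?_)
        filter_upwards [compl_mem_ae_iff.2 (measure_singleton (μ := volume) (0 : ℝ))] with y hy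
        exact lintegral_gammaPDF_mul_gaussianPDF θ hσ hν ht hy

/-! ### Half-line moments and the single series. -/

theorem measurable_besselInt (a : ℝ) : Measurable (besselInt a) :=
  ((measurable_besselKernel a).stronglyMeasurable.integral_prod_right
    (ν := volume.restrict (Ioi (0 : ℝ)))).measurable

theorem ofReal_besselInt (a : ℝ) {x : ℝ} (hx : 0 < x) :
    ENNReal.ofReal (besselInt a x) = ∫⁻ v in Ioi (0 : ℝ), ENNReal.ofReal (besselKernel a x v) := by
  refine ofReal_integral_eq_lintegral_ofReal (integrableOn_besselKernel a hx) ?_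
  filter_upwards [ae_restrict_mem measurableSet_Ioi] with v hv
  exact besselKernel_nonneg _ _ (le_of_lt hv)

theorem lintegral_pow_mul_besselKernel (a : ℝ) {q v : ℝ} (hq : 0 < q) (hv : 0 < v) (n : ℕ) :
    ∫⁻ y in Ioi (0 : ℝ), ENNReal.ofReal (y ^ n * besselKernel a (q * y ^ 2) v)
      = ENNReal.ofReal (1 / 2 * Real.Gamma (((n : ℝ) + 1) / 2) * q ^ (-((n : ℝ) + 1) / 2)
        * (Real.exp (-v) * v ^ (((n : ℝ) + 1) / 2 + a - 1))) := by
  have hn : (0 : ℝ) ≤ n := Nat.cast_nonneg n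
  have hqv : 0 < q / v := div_pos hq hv
  have hint := ((integrable_rpow_mul_exp_neg_mul_sq hqv (s := n) (by linarith)).const_mul
    (Real.exp (-v) * v ^ (a - 1))).integrableOn (s := Ioi 0)
  have e : ∀ y : ℝ, y ^ n * besselKernel a (q * y ^ 2) v
      = Real.exp (-v) * v ^ (a - 1) * (y ^ (n : ℝ) * Real.exp (-(q / v) * y ^ 2)) := by
    intro y
    unfold besselKernel
    rw [Real.rpow_natCast, neg_add, Real.exp_add]
    have : -(q * y ^ 2 / v) = -(q / v) * y ^ 2 := by ring
    rw [this]
    ring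
  simp only [e]
  rw [← ofReal_integral_eq_lintegral_ofReal hint]
  · rw [integral_const_mul]
    have h := integral_rpow_mul_exp_neg_mul_rpow (p := 2) (q := n) two_pos (by linarith) hqv
    simp only [Real.rpow_two] at h
    rw [h, Real.div_rpow hq.le hv.le,
      show ((n : ℝ) + 1) / 2 + a - 1 = (a - 1) - (-((n : ℝ) + 1) / 2) by ring,
      Real.rpow_sub hv (a - 1) (-((n : ℝ) + 1) / 2)]
    congr 1
    ring
  · filter_upwards [ae_restrict_mem measurableSet_Ioi] with y hy
    have hy : 0 < y := hy
    simp only [Pi.zero_apply]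
    positivity

/-- Tonelli: the Gaussian moment in y gives the first Gamma factor, the remaining integral in v the
second. The bound on a is what convergence in v requires at n = 0. -/
theorem lintegral_pow_mul_besselInt {a q : ℝ} (ha : -(1 / 2) < a) (hq : 0 < q) (n : ℕ) :
    ∫⁻ y in Ioi (0 : ℝ), ENNReal.ofReal (y ^ n * besselInt a (q * y ^ 2))
      = ENNReal.ofReal (1 / 2 * Real.Gamma (((n : ℝ) + 1) / 2) * q ^ (-((n : ℝ) + 1) / 2)
        * Real.Gamma (((n : ℝ) + 1) / 2 + a)) := by
  have hn : (0 : ℝ) ≤ n := Nat.cast_nonneg n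
  have hG : 0 < ((n : ℝ) + 1) / 2 + a := by linarith
  have hG2 := Real.Gamma_pos_of_pos (by linarith : 0 < ((n : ℝ) + 1) / 2)
  calc _ = ∫⁻ y in Ioi (0 : ℝ), ∫⁻ v in Ioi (0 : ℝ),
        ENNReal.ofReal (y ^ n * besselKernel a (q * y ^ 2) v) := by
        refine setLIntegral_congr_fun measurableSet_Ioi fun y hy => ?_
        have hy : 0 < y := hy
        have hm : Measurable fun v => ENNReal.ofReal (besselKernel a (q * y ^ 2) v) :=
          ((measurable_besselKernel a).comp measurable_prodMk_left).ennreal_ofReal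
        rw [ENNReal.ofReal_mul (by positivity), ofReal_besselInt a (by positivity),
          ← lintegral_const_mul _ hm]
        refine lintegral_congr fun v => ?_
        rw [ENNReal.ofReal_mul (by positivity)]
    _ = ∫⁻ v in Ioi (0 : ℝ), ∫⁻ y in Ioi (0 : ℝ),
        ENNReal.ofReal (y ^ n * besselKernel a (q * y ^ 2) v) := by
        refine lintegral_lintegral_swap (Measurable.aemeasurable ?_)
        unfold besselKernel
        fun_prop
    _ = ∫⁻ v in Ioi (0 : ℝ), ENNReal.ofReal (1 / 2 * Real.Gamma (((n : ℝ) + 1) / 2)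
        * q ^ (-((n : ℝ) + 1) / 2) * (Real.exp (-v) * v ^ (((n : ℝ) + 1) / 2 + a - 1))) :=
        setLIntegral_congr_fun measurableSet_Ioi fun v hv =>
          lintegral_pow_mul_besselKernel a hq hv n
    _ = _ := by
        rw [← ofReal_integral_eq_lintegral_ofReal
          ((Real.GammaIntegral_convergent hG).const_mul _), integral_const_mul,
          Real.Gamma_eq_integral hG]
        filter_upwards [ae_restrict_mem measurableSet_Ioi] with v hv
        have hv : 0 < v := hv
        simp only [Pi.zero_apply]
        positivity

theorem integrableOn_pow_mul_besselInt {a q : ℝ} (ha : -(1 / 2) < a) (hq : 0 < q) (n : ℕ) :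
    IntegrableOn (fun y => y ^ n * besselInt a (q * y ^ 2)) (Ioi 0) := by
  have hm : Measurable fun y : ℝ => y ^ n * besselInt a (q * y ^ 2) :=
    (by fun_prop : Measurable fun y : ℝ => y ^ n).mul
      ((measurable_besselInt a).comp (by fun_prop))
  refine ⟨hm.aestronglyMeasurable, ?_⟩
  rw [hasFiniteIntegral_iff_ofReal, lintegral_pow_mul_besselInt ha hq]
  · exact ENNReal.ofReal_lt_top
  · filter_upwards [ae_restrict_mem measurableSet_Ioi] with y hy
    exact mul_nonneg (pow_nonneg (le_of_lt hy) _) (besselInt_nonneg _ _)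

theorem integral_pow_mul_besselInt {a q : ℝ} (ha : -(1 / 2) < a) (hq : 0 < q) (n : ℕ) :
    ∫ y in Ioi (0 : ℝ), y ^ n * besselInt a (q * y ^ 2)
      = 1 / 2 * Real.Gamma (((n : ℝ) + 1) / 2) * q ^ (-((n : ℝ) + 1) / 2)
        * Real.Gamma (((n : ℝ) + 1) / 2 + a) := by
  have hn : (0 : ℝ) ≤ n := Nat.cast_nonneg n
  have hG := Real.Gamma_pos_of_pos (by linarith : 0 < ((n : ℝ) + 1) / 2 + a)
  have hG2 := Real.Gamma_pos_of_pos (by linarith : 0 < ((n : ℝ) + 1) / 2)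
  rw [integral_eq_lintegral_of_nonneg_ae, lintegral_pow_mul_besselInt ha hq,
    ENNReal.toReal_ofReal (by positivity)]
  · filter_upwards [ae_restrict_mem measurableSet_Ioi] with y hy
    exact mul_nonneg (pow_nonneg (le_of_lt hy) _) (besselInt_nonneg _ _)
  · exact (integrableOn_pow_mul_besselInt ha hq n).aestronglyMeasurable

theorem singleTerm_eq_integral {a q : ℝ} (ha : -(1 / 2) < a) (hq : 0 < q) (ϑ : ℝ) (n : ℕ) :
    singleTerm a q ϑ n = 2 * q ^ (-a)
      * ∫ y in Ioi (0 : ℝ), (ϑ * y) ^ n / (n.factorial : ℝ) * besselInt a (q * y ^ 2) := by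
  have e : ∀ y : ℝ, (ϑ * y) ^ n / (n.factorial : ℝ) * besselInt a (q * y ^ 2)
      = ϑ ^ n / (n.factorial : ℝ) * (y ^ n * besselInt a (q * y ^ 2)) := fun y => by
    rw [mul_pow]; ring
  simp only [e]
  rw [integral_const_mul, integral_pow_mul_besselInt ha hq]
  unfold singleTerm
  rw [sub_eq_add_neg, Real.rpow_add hq]
  ring

theorem neg_half_lt_alpha {t ν : ℝ} (ht : 0 < t) (hν : 0 < ν) : -(1 / 2) < alpha t ν := by
  have := div_pos ht hν
  unfold alpha
  linarith

theorem tsum_pow_div_factorial (x : ℝ) : ∑' n : ℕ, x ^ n / (n.factorial : ℝ) = Real.exp x := by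
  rw [Real.exp_eq_exp_ℝ, NormedSpace.exp_eq_tsum_div]

/-- With |θ_σ| all terms are nonnegative, and up to the prefactor they sum to the mass of (0, ∞)
under the law with drift |θ|, which is finite. -/
theorem summable_singleTerm_abs {σ ν t : ℝ} (θ : ℝ) (hσ : 0 < σ) (hν : 0 < ν) (ht : 0 < t) :
    Summable (singleTerm (alpha t ν) (qPar σ ν θ) |thetaSigma σ θ|) := by
  have hq := qPar_pos θ hσ hν
  have ha := neg_half_lt_alpha ht hν
  have hP := prefactor_pos 0 ht hν (sigmaNu_pos hσ hν)
  set P := prefactor 0 t ν (sigmaNu σ ν)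
  set ϑ := |thetaSigma σ θ| with hϑ
  have hϑ0 : 0 ≤ ϑ := abs_nonneg _
  have hterm : ∀ n, ENNReal.ofReal (P * singleTerm (alpha t ν) (qPar σ ν θ) ϑ n)
      = ∫⁻ y in Ioi (0 : ℝ), ENNReal.ofReal (2 * P * qPar σ ν θ ^ (-alpha t ν)
        * ((ϑ * y) ^ n / (n.factorial : ℝ)
        * besselInt (alpha t ν) (qPar σ ν θ * y ^ 2))) := by
    intro n
    have hint := (integrableOn_pow_mul_besselInt ha hq n).const_mul
      (2 * P * qPar σ ν θ ^ (-alpha t ν) * (ϑ ^ n / (n.factorial : ℝ)))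
    rw [← ofReal_integral_eq_lintegral_ofReal]
    · rw [integral_const_mul, singleTerm_eq_integral ha hq]
      congr 1
      ring
    · refine hint.congr (Eventually.of_forall fun y => ?_)
      simp only [mul_pow]
      ring
    · filter_upwards [ae_restrict_mem measurableSet_Ioi] with y hy
      have hy : 0 < y := hy
      have := besselInt_nonneg (alpha t ν) (qPar σ ν θ * y ^ 2)
      simp only [Pi.zero_apply]
      positivity
  have hsum : ∑' n, ENNReal.ofReal (P * singleTerm (alpha t ν) (qPar σ ν θ) ϑ n)
      = vgLaw σ ν |θ| t (Ioi 0) := by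
    simp only [hterm]
    rw [vgLaw_apply _ hσ hν ht measurableSet_Ioi, ← lintegral_tsum]
    · refine setLIntegral_congr_fun measurableSet_Ioi fun y hy => ?_
      have hy : 0 < y := hy
      have hb := besselInt_nonneg (alpha t ν) (qPar σ ν θ * y ^ 2)
      rw [← ENNReal.ofReal_tsum_of_nonneg (fun n => by positivity)
        (((Real.summable_pow_div_factorial _).mul_right _).mul_left _), tsum_mul_left,
        tsum_mul_right, tsum_pow_div_factorial, vgDensity, qPar_abs, thetaSigma_abs]
    · intro n
      refine (Measurable.ennreal_ofReal ?_).aemeasurable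
      refine Measurable.const_mul (Measurable.mul (by fun_prop) ?_) _
      exact (measurable_besselInt _).comp (by fun_prop)
  have := isProbabilityMeasure_vgLaw (σ := σ) |θ| hν ht
  have hs := ENNReal.summable_toReal (hsum ▸ measure_ne_top (vgLaw σ ν |θ| t) (Ioi 0))
  have hnn : ∀ n, 0 ≤ singleTerm (alpha t ν) (qPar σ ν θ) ϑ n := fun n => by
    rw [singleTerm_eq_integral ha hq]
    refine mul_nonneg (by positivity) (setIntegral_nonneg measurableSet_Ioi fun y hy => ?_)
    have hy : 0 < y := hy
    have := besselInt_nonneg (alpha t ν) (qPar σ ν θ * y ^ 2)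
    positivity
  simp only [fun n => ENNReal.toReal_ofReal (mul_nonneg hP.le (hnn n))] at hs
  exact (summable_mul_left_iff hP.ne').1 hs

theorem abs_singleTerm {a q : ℝ} (ha : -(1 / 2) < a) (hq : 0 < q) (ϑ : ℝ) (n : ℕ) :
    |singleTerm a q ϑ n| = singleTerm a q |ϑ| n := by
  have hn : (0 : ℝ) ≤ n := Nat.cast_nonneg n
  have hG := Real.Gamma_pos_of_pos (by linarith : 0 < ((n : ℝ) + 1) / 2 + a)
  have hG2 := Real.Gamma_pos_of_pos (by linarith : 0 < ((n : ℝ) + 1) / 2)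
  unfold singleTerm
  rw [abs_mul, abs_pow, abs_of_nonneg (by positivity)]

theorem summable_singleTerm {σ ν t : ℝ} (θ : ℝ) (hσ : 0 < σ) (hν : 0 < ν) (ht : 0 < t) :
    Summable (singleTerm (alpha t ν) (qPar σ ν θ) (thetaSigma σ θ)) := by
  refine Summable.of_abs ?_
  simp only [abs_singleTerm (neg_half_lt_alpha ht hν) (qPar_pos θ hσ hν)]
  exact summable_singleTerm_abs θ hσ hν ht

theorem vgLaw_real_apply {σ ν t : ℝ} (θ : ℝ) (hσ : 0 < σ) (hν : 0 < ν) (ht : 0 < t) {s : Set ℝ}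
    (hs : MeasurableSet s) :
    (vgLaw σ ν θ t).real s = ∫ y in s, vgDensity σ ν θ t y := by
  have hm : Measurable (vgDensity σ ν θ t) := by
    unfold vgDensity
    refine Measurable.const_mul (Measurable.mul (by fun_prop) ?_) _
    exact (measurable_besselInt _).comp (by fun_prop)
  rw [Measure.real, vgLaw_apply θ hσ hν ht hs, integral_eq_lintegral_of_nonneg_ae
    (Eventually.of_forall fun y => vgDensity_nonneg θ y hσ hν ht) hm.aestronglyMeasurable]

theorem vgLaw_real_Ioi_zero {σ ν t : ℝ} (θ : ℝ) (hσ : 0 < σ) (hν : 0 < ν) (ht : 0 < t) :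
    (vgLaw σ ν θ t).real (Ioi 0) = prefactor 0 t ν (sigmaNu σ ν)
      * ∑' n, singleTerm (alpha t ν) (qPar σ ν θ) (thetaSigma σ θ) n := by
  have hq := qPar_pos θ hσ hν
  have ha := neg_half_lt_alpha ht hν
  have hqa : 0 < 2 * qPar σ ν θ ^ (-alpha t ν) := by positivity
  have hint : ∀ n : ℕ, IntegrableOn (fun y : ℝ => (thetaSigma σ θ * y) ^ n / (n.factorial : ℝ)
      * besselInt (alpha t ν) (qPar σ ν θ * y ^ 2)) (Ioi 0) := fun n => by
    refine ((integrableOn_pow_mul_besselInt ha hq n).const_mul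
      (thetaSigma σ θ ^ n / (n.factorial : ℝ))).congr (Eventually.of_forall fun y => ?_)
    simp only [mul_pow]
    ring
  -- Up to the constant 2q^(-α), these integrals of norms are the terms of the series with |θ_σ|.
  have hs : Summable fun n : ℕ => ∫ y in Ioi (0 : ℝ), ‖(thetaSigma σ θ * y) ^ n
      / (n.factorial : ℝ) * besselInt (alpha t ν) (qPar σ ν θ * y ^ 2)‖ := by
    rw [← summable_mul_left_iff hqa.ne']
    refine (summable_singleTerm_abs θ hσ hν ht).congr fun n => ?_
    rw [singleTerm_eq_integral ha hq]
    congr 1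
    refine setIntegral_congr_fun measurableSet_Ioi fun y hy => ?_
    have hy : 0 < y := hy
    simp only [norm_mul, norm_div, norm_pow, Real.norm_eq_abs, abs_of_pos hy, Nat.abs_cast,
      abs_of_nonneg (besselInt_nonneg (alpha t ν) (qPar σ ν θ * y ^ 2))]
  have h := (hasSum_integral_of_summable_integral_norm hint hs).tsum_eq
  simp only [singleTerm_eq_integral ha hq]
  rw [tsum_mul_left, h, vgLaw_real_apply θ hσ hν ht measurableSet_Ioi]
  simp only [tsum_mul_right, tsum_pow_div_factorial]
  unfold vgDensity
  rw [integral_const_mul]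
  ring

/-! ### The double series over (0, x] and the tail probabilities. -/

/-- The `n`-th term of the expansion of `y ↦ q ^ (-a) * besselInt a (q * y ^ 2)`. -/
def besselTerm (a q : ℝ) (n : ℕ) (y : ℝ) : ℝ :=
  besselCoeff a n * q ^ (-a + (n : ℝ)) * y ^ (2 * n)
    + besselCoeff (-a) n * q ^ n * y ^ (2 * (n : ℝ) + 2 * a)

theorem tsum_besselTerm {a q y : ℝ} (hai : ∀ m : ℤ, a ≠ m) (hq : 0 < q) (hy : 0 < y) :
    Summable (fun n => ‖besselTerm a q n y‖) ∧
      ∑' n, besselTerm a q n y = q ^ (-a) * besselInt a (q * y ^ 2) := by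
  have hx : 0 < q * y ^ 2 := by positivity
  have n1 : ∀ n : ℕ, a ≠ n := fun n => by exact_mod_cast hai n
  have n2 : ∀ n : ℕ, -a ≠ n := fun n h => hai (-n) (by push_cast; linarith)
  have e : ∀ n, besselTerm a q n y = q ^ (-a) * (besselCoeff a n * (q * y ^ 2) ^ n)
      + q ^ (-a) * (q * y ^ 2) ^ a * (besselCoeff (-a) n * (q * y ^ 2) ^ n) := by
    intro n
    have h1 : q ^ (-a) * (q * y ^ 2) ^ a = y ^ (2 * a) := by
      rw [Real.mul_rpow hq.le (by positivity), ← mul_assoc, ← Real.rpow_add hq, neg_add_cancel,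
        Real.rpow_zero, one_mul, ← Real.rpow_natCast, ← Real.rpow_mul hy.le]
      norm_num
    rw [h1, besselTerm, Real.rpow_add hq, Real.rpow_natCast, Real.rpow_add hy,
      show 2 * (n : ℝ) = ((2 * n : ℕ) : ℝ) by push_cast; ring, Real.rpow_natCast, mul_pow,
      ← pow_mul]
    ring
  have s1 := (summable_norm_besselCoeff a (q * y ^ 2) n1).of_norm.mul_left (q ^ (-a))
  have s2 := (summable_norm_besselCoeff (-a) (q * y ^ 2) n2).of_norm.mul_left
    (q ^ (-a) * (q * y ^ 2) ^ a)
  constructor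
  · exact (by simpa only [e] using s1.add s2 : Summable fun n => besselTerm a q n y).norm
  · simp only [e]
    rw [s1.tsum_add s2, tsum_mul_left, tsum_mul_left, besselInt_eq hai hx]
    unfold besselSeries
    ring

/-- Power rule on each monomial; the sign comes from the negative denominators in `doubleTerm`. -/
theorem integral_besselTerm_mul {a x : ℝ} (q ϑ : ℝ) (ha : -(1 / 2) < a) (hx : 0 < x)
    (n : ℕ × ℕ) :
    IntervalIntegrable (fun y => besselTerm a q n.1 y * ((ϑ * y) ^ n.2 / (n.2.factorial : ℝ)))
        volume 0 x ∧
      ∫ y in (0 : ℝ)..x, besselTerm a q n.1 y * ((ϑ * y) ^ n.2 / (n.2.factorial : ℝ))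
        = -doubleTerm a (-x) q ϑ n := by
  obtain ⟨n, m⟩ := n
  have hn : (0 : ℝ) ≤ n := Nat.cast_nonneg n
  have hm : (0 : ℝ) ≤ m := Nat.cast_nonneg m
  have i1 : IntervalIntegrable (fun y : ℝ => (besselCoeff a n * q ^ (-a + (n : ℝ)) * ϑ ^ m
      / (m.factorial : ℝ)) * y ^ (2 * n + m)) volume 0 x :=
    (intervalIntegral.intervalIntegrable_pow _).const_mul _
  have i2 : IntervalIntegrable (fun y : ℝ => (besselCoeff (-a) n * q ^ n * ϑ ^ m
      / (m.factorial : ℝ)) * y ^ (2 * (n : ℝ) + m + 2 * a)) volume 0 x :=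
    (intervalIntegral.intervalIntegrable_rpow' (by linarith)).const_mul _
  have e : ∀ y ∈ uIoc 0 x, (besselCoeff a n * q ^ (-a + (n : ℝ)) * ϑ ^ m
      / (m.factorial : ℝ)) * y ^ (2 * n + m) + (besselCoeff (-a) n * q ^ n * ϑ ^ m
      / (m.factorial : ℝ)) * y ^ (2 * (n : ℝ) + m + 2 * a)
      = besselTerm a q n y * ((ϑ * y) ^ m / (m.factorial : ℝ)) := by
    intro y hy
    rw [uIoc_of_le hx.le] at hy
    have hy : 0 < y := hy.1
    unfold besselTerm
    rw [show 2 * (n : ℝ) + m + 2 * a = (2 * (n : ℝ) + 2 * a) + m by ring,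
      Real.rpow_add_natCast hy.ne', pow_add, mul_pow]
    ring
  refine ⟨(i1.add i2).congr e, ?_⟩
  simp only []
  rw [← intervalIntegral.integral_congr_ae (Eventually.of_forall e),
    intervalIntegral.integral_add i1 i2, intervalIntegral.integral_const_mul,
    intervalIntegral.integral_const_mul, integral_pow, integral_rpow (Or.inl (by linarith)),
    zero_pow (by omega), Real.zero_rpow (by linarith)]
  unfold doubleTerm besselCoeff
  have h1 : 2 * (n : ℝ) + m + 1 ≠ 0 := by positivity
  have h2 : 2 * (n : ℝ) + m + 2 * a + 1 ≠ 0 := by linarith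
  have h3 : -2 * (n : ℝ) - m - 1 = -(2 * (n : ℝ) + m + 1) := by ring
  have h4 : -2 * (n : ℝ) - m - 1 - 2 * a = -(2 * (n : ℝ) + m + 2 * a + 1) := by ring
  have h5 : 2 * (n : ℝ) + m + 1 + 2 * a = 2 * (n : ℝ) + m + 2 * a + 1 := by ring
  simp only [neg_neg]
  rw [h4, h3, h5]
  push_cast
  generalize x ^ (2 * (n : ℝ) + m + 2 * a + 1) = A
  generalize x ^ (2 * n + m + 1) = B
  generalize q ^ (-a + (n : ℝ)) = C
  field_simp
  ring

/-- Integer powers of y are bounded by those of x. The factor y^(2a), possibly singular at 0, is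
kept and integrated, using 2a > -1. What remains is a product of two convergent series. -/
theorem summable_integral_norm_besselTerm_mul {a q x : ℝ} (ϑ : ℝ) (hai : ∀ m : ℤ, a ≠ m)
    (ha : -(1 / 2) < a) (hq : 0 < q) (hx : 0 < x) :
    Summable fun n : ℕ × ℕ => ∫ y in Ioc 0 x,
      ‖besselTerm a q n.1 y * ((ϑ * y) ^ n.2 / (n.2.factorial : ℝ))‖ := by
  have n1 : ∀ n : ℕ, a ≠ n := fun n => by exact_mod_cast hai n
  have n2 : ∀ n : ℕ, -a ≠ n := fun n h => hai (-n) (by push_cast; linarith)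
  have s1 := (summable_norm_besselCoeff a (q * x ^ 2) n1).mul_left (q ^ (-a) * x)
  have s2 := (summable_norm_besselCoeff (-a) (q * x ^ 2) n2).mul_left
    (x ^ (2 * a + 1) / (2 * a + 1))
  have s3 := Real.summable_pow_div_factorial (|ϑ| * x)
  have hs := (s1.add s2).mul_of_nonneg s3 (fun n => by
    have : 0 < 2 * a + 1 := by linarith
    simp only [Pi.zero_apply]
    positivity) (fun n => by
    simp only [Pi.zero_apply]
    positivity)
  refine Summable.of_nonneg_of_le (fun n => integral_nonneg fun y => norm_nonneg _)
    (fun n => ?_) hs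
  obtain ⟨n, m⟩ := n
  have hb : ∀ y ∈ Ioc 0 x, ‖besselTerm a q n y * ((ϑ * y) ^ m / (m.factorial : ℝ))‖
      ≤ (q ^ (-a) * ‖besselCoeff a n * (q * x ^ 2) ^ n‖
        + ‖besselCoeff (-a) n * (q * x ^ 2) ^ n‖ * y ^ (2 * a))
        * ((|ϑ| * x) ^ m / (m.factorial : ℝ)) := by
    intro y hy
    obtain ⟨hy, hyx⟩ := hy
    rw [norm_mul]
    refine mul_le_mul ?_ ?_ (norm_nonneg _) (by positivity)
    · refine (norm_add_le _ _).trans (add_le_add ?_ ?_)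
      · rw [Real.rpow_add hq, Real.rpow_natCast]
        simp only [norm_mul, norm_pow, Real.norm_eq_abs, abs_of_pos hq, abs_of_pos hy,
          abs_of_pos hx, abs_of_pos (Real.rpow_pos_of_pos hq (-a)), mul_pow, ← pow_mul]
        have := pow_le_pow_left₀ hy.le hyx (2 * n)
        have h0 : 0 ≤ q ^ (-a) * (|besselCoeff a n| * q ^ n) := by positivity
        nlinarith [mul_le_mul_of_nonneg_left this h0]
      · rw [Real.rpow_add hy, show 2 * (n : ℝ) = ((2 * n : ℕ) : ℝ) by push_cast; ring,
          Real.rpow_natCast]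
        simp only [norm_mul, norm_pow, Real.norm_eq_abs, abs_of_pos hq, abs_of_pos hy,
          abs_of_pos hx, abs_of_pos (Real.rpow_pos_of_pos hy (2 * a)), mul_pow, ← pow_mul]
        have := pow_le_pow_left₀ hy.le hyx (2 * n)
        have h0 : 0 ≤ y ^ (2 * a) * (|besselCoeff (-a) n| * q ^ n) := by positivity
        nlinarith [mul_le_mul_of_nonneg_left this h0]
    · simp only [norm_div, norm_pow, norm_mul, Real.norm_eq_abs, abs_of_pos hy, Nat.abs_cast]
      gcongr
  have hi : IntervalIntegrable (fun y : ℝ => y ^ (2 * a)) volume 0 x :=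
    intervalIntegral.intervalIntegrable_rpow' (by linarith)
  have hj := hi.const_mul ‖besselCoeff (-a) n * (q * x ^ 2) ^ n‖
  have hc : IntervalIntegrable (fun _ : ℝ => q ^ (-a) * ‖besselCoeff a n * (q * x ^ 2) ^ n‖)
    volume 0 x := intervalIntegrable_const
  have hk := (hc.add hj).mul_const ((|ϑ| * x) ^ m / (m.factorial : ℝ))
  have hF := (integral_besselTerm_mul q ϑ ha hx (n, m)).1
  refine (setIntegral_mono_on
    ((intervalIntegrable_iff_integrableOn_Ioc_of_le hx.le).1 hF).norm
    ((intervalIntegrable_iff_integrableOn_Ioc_of_le hx.le).1 hk) measurableSet_Ioc hb).trans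
    (le_of_eq ?_)
  rw [← intervalIntegral.integral_of_le hx.le, intervalIntegral.integral_mul_const,
    intervalIntegral.integral_add hc hj, intervalIntegral.integral_const,
    intervalIntegral.integral_const_mul, integral_rpow (Or.inl (by linarith)),
    Real.zero_rpow (by linarith), smul_eq_mul]
  ring

theorem hasSum_doubleTerm {a q x : ℝ} (ϑ : ℝ) (hai : ∀ m : ℤ, a ≠ m)
    (ha : -(1 / 2) < a) (hq : 0 < q) (hx : 0 < x) :
    HasSum (doubleTerm a (-x) q ϑ) (-∫ y in Ioc 0 x,
      q ^ (-a) * (Real.exp (ϑ * y) * besselInt a (q * y ^ 2))) := by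
  have h := hasSum_integral_of_summable_integral_norm
    (fun n => (intervalIntegrable_iff_integrableOn_Ioc_of_le hx.le).1
      (integral_besselTerm_mul q ϑ ha hx n).1)
    (summable_integral_norm_besselTerm_mul ϑ hai ha hq hx)
  have e : ∫ y in Ioc 0 x, ∑' n : ℕ × ℕ,
      besselTerm a q n.1 y * ((ϑ * y) ^ n.2 / (n.2.factorial : ℝ))
      = ∫ y in Ioc 0 x, q ^ (-a) * (Real.exp (ϑ * y) * besselInt a (q * y ^ 2)) := by
    refine setIntegral_congr_fun measurableSet_Ioc fun y hy => ?_
    obtain ⟨h1, h2⟩ := tsum_besselTerm hai hq hy.1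
    rw [← tsum_mul_tsum_of_summable_norm h1 (Real.summable_pow_div_factorial _).norm, h2,
      tsum_pow_div_factorial]
    ring
  rw [e] at h
  refine h.neg.congr_fun fun n => ?_
  rw [← intervalIntegral.integral_of_le hx.le, (integral_besselTerm_mul q ϑ ha hx n).2, neg_neg]

theorem vgLaw_real_Ioi {σ ν t x : ℝ} (r θ : ℝ) (hσ : 0 < σ) (hν : 0 < ν) (ht : 0 < t)
    (hai : ∀ m : ℤ, alpha t ν ≠ m) (hx : 0 < x) :
    Real.exp (-r * t) * (vgLaw σ ν θ t).real (Ioi x)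
      = cMinus r t ν (-x) (qPar σ ν θ) (sigmaNu σ ν) (thetaSigma σ θ) := by
  have hp := isProbabilityMeasure_vgLaw (σ := σ) θ hν ht
  have h := measureReal_union (μ := vgLaw σ ν θ t) (Ioc_disjoint_Ioi_same (a := 0) (b := x))
    measurableSet_Ioi
  rw [Ioc_union_Ioi_eq_Ioi hx.le, vgLaw_real_Ioi_zero θ hσ hν ht,
    vgLaw_real_apply θ hσ hν ht measurableSet_Ioc] at h
  have hd := (hasSum_doubleTerm (thetaSigma σ θ) hai (neg_half_lt_alpha ht hν)
    (qPar_pos θ hσ hν) hx).tsum_eq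
  unfold vgDensity at h
  -- Moves q^(-α) into the integrand, as in `hasSum_doubleTerm`; the constant left outside is twice
  -- the prefactor, whence the 2 before the double series.
  simp only [mul_assoc _ (qPar σ ν θ ^ (-alpha t ν)) _] at h
  rw [integral_const_mul] at h
  unfold cMinus
  rw [hd, prefactor_eq_exp_mul]
  linear_combination (-Real.exp (-r * t)) * h

theorem vgLaw_real_Iio {σ ν t : ℝ} (θ x : ℝ) (hσ : 0 < σ) (hν : 0 < ν) (ht : 0 < t) :
    (vgLaw σ ν θ t).real (Iio (-x)) = (vgLaw σ ν (-θ) t).real (Ioi x) := by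
  rw [vgLaw_real_apply _ hσ hν ht measurableSet_Ioi, vgLaw_real_apply _ hσ hν ht measurableSet_Iio]
  simp only [vgDensity_neg]
  rw [integral_comp_neg_Ioi, integral_Iic_eq_integral_Iio]

/-- Complement, then reflection: the mass below -x is the upper tail at x for drift -θ, and the
point -x carries no mass. -/
theorem vgLaw_real_Ioi_neg {σ ν t x : ℝ} (r θ : ℝ) (hσ : 0 < σ) (hν : 0 < ν) (ht : 0 < t)
    (hai : ∀ m : ℤ, alpha t ν ≠ m) (hx : 0 < x) :
    Real.exp (-r * t) * (vgLaw σ ν θ t).real (Ioi (-x))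
      = Real.exp (-r * t)
        - cMinus r t ν (-x) (qPar σ ν θ) (sigmaNu σ ν) (-thetaSigma σ θ) := by
  have hp := isProbabilityMeasure_vgLaw (σ := σ) θ hν ht
  have h := vgLaw_real_Ioi r (-θ) hσ hν ht hai hx
  rw [qPar_neg, thetaSigma_neg, ← vgLaw_real_Iio θ x hσ hν ht] at h
  have h1 := probReal_add_probReal_compl (μ := vgLaw σ ν θ t) (measurableSet_Iic (a := -x))
  have h2 : (vgLaw σ ν θ t).real (Iic (-x)) = (vgLaw σ ν θ t).real (Iio (-x)) := by
    rw [vgLaw_real_apply θ hσ hν ht measurableSet_Iic,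
      vgLaw_real_apply θ hσ hν ht measurableSet_Iio, integral_Iic_eq_integral_Iio]
  rw [compl_Iic, h2] at h1
  rw [← h]
  linear_combination Real.exp (-r * t) * h1

/-! ### From the conditional expectation to the tail, and conclusion. -/

/-- Conditional probability that an independent `D` exceeds an `m`-measurable level. -/
theorem condExp_indicator_lt_of_indep {Ω : Type*} {m mΩ : MeasurableSpace Ω} {Q : Measure Ω}
    [IsProbabilityMeasure Q] (hm : m ≤ mΩ) {D Y : Ω → ℝ} (hD : Measurable D)
    (hY : Measurable[m] Y) (hi : Indep (MeasurableSpace.comap D inferInstance) m Q) (c : ℝ) :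
    Q[fun w => c * (if Y w < D w then 1 else 0) | m]
      =ᵐ[Q] fun w => c * (Q.map D).real (Ioi (Y w)) := by
  have hY' : Measurable Y := hY.mono hm le_rfl
  have : IsProbabilityMeasure (Q.map D) := Measure.isProbabilityMeasure_map hD.aemeasurable
  have hS : MeasurableSet {p : ℝ × ℝ | p.1 < p.2} := measurableSet_lt measurable_fst measurable_snd
  have hh : Measurable fun x : ℝ => (Q.map D).real (Ioi x) :=
    (measurable_measure_prodMk_left (ν := Q.map D) hS).ennreal_toReal
  have hf : Integrable (fun w => c * (if Y w < D w then (1 : ℝ) else 0)) Q := by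
    refine Integrable.const_mul ?_ c
    refine Integrable.of_bound (C := 1)
      (Measurable.ite (measurableSet_lt hY' hD) measurable_const
        measurable_const).aestronglyMeasurable (Eventually.of_forall fun w => ?_)
    split_ifs <;> simp
  have hg : Integrable (fun w => c * (Q.map D).real (Ioi (Y w))) Q := by
    refine Integrable.const_mul ?_ c
    refine Integrable.of_bound (C := 1) (hh.comp hY').aestronglyMeasurable
      (Eventually.of_forall fun w => ?_)
    rw [Real.norm_of_nonneg measureReal_nonneg]
    exact measureReal_le_one
  refine (ae_eq_condExp_of_forall_setIntegral_eq hm hf (fun _ _ _ => hg.integrableOn) ?_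
    ((hh.comp hY).const_mul c).stronglyMeasurable.aestronglyMeasurable).symm
  intro A hA _
  rw [integral_const_mul, integral_const_mul]
  congr 1
  -- Independence is applied to D⁻¹(t) and Y⁻¹(s) ∩ A, the latter being m-measurable: on each A the
  -- pair (Y, D) has a product law, and Fubini evaluates the probability of Y < D.
  have hprod : ((Q.restrict A).map Y).prod (Q.map D)
      = (Q.restrict A).map fun w => (Y w, D w) := by
    refine Measure.prod_eq fun s t hs ht => ?_
    rw [Measure.map_apply (hY'.prodMk hD) (hs.prod ht), Measure.map_apply hY' hs,
      Measure.map_apply hD ht, Measure.restrict_apply ((hY'.prodMk hD) (hs.prod ht)),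
      Measure.restrict_apply (hY' hs)]
    have := (Indep_iff _ _ Q).1 hi (D ⁻¹' t) (Y ⁻¹' s ∩ A) ⟨t, ht, rfl⟩ ((hY hs).inter hA)
    rw [mul_comm, ← this]
    congr 1
    ext w
    simp only [mem_inter_iff, mem_preimage, mem_prod]
    tauto
  have h1 : ∫ w in A, (if Y w < D w then (1 : ℝ) else 0) ∂Q
      = (((Q.restrict A).map Y).prod (Q.map D)).real {p : ℝ × ℝ | p.1 < p.2} := by
    rw [hprod, measureReal_def, Measure.map_apply (hY'.prodMk hD) hS, ← measureReal_def,
      ← integral_indicator_one (hY'.prodMk hD hS)]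
    refine integral_congr_ae (Eventually.of_forall fun w => ?_)
    simp [indicator]
  rw [h1, measureReal_def, Measure.prod_apply hS, ← integral_map (φ := Y) hY'.aemeasurable
    (f := fun x => (Q.map D).real (Ioi x)) hh.aestronglyMeasurable]
  exact integral_toReal (measurable_measure_prodMk_left hS).aemeasurable
    (Eventually.of_forall fun x => measure_lt_top _ _)

theorem cashOrNothing_stock {Ω : Type*} {S₀ K : ℝ} (r σ ν θ : ℝ) (hS₀ : 0 < S₀) (hK : 0 < K)
    (X : ℝ≥0 → Ω → ℝ) (t T : ℝ≥0) (w : Ω) :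
    cashOrNothing K (stock S₀ r σ ν θ X T w)
      = if -moneyness (stock S₀ r σ ν θ X t w) K r (T - t) σ ν θ < X T w - X t w
        then 1 else 0 := by
  unfold cashOrNothing
  refine if_congr ?_ rfl rfl
  unfold moneyness stock
  rw [Real.log_div (by positivity) hK.ne', Real.log_mul hS₀.ne' (Real.exp_ne_zero _), Real.log_exp,
    ← Real.log_lt_log_iff hK (by positivity), Real.log_mul hS₀.ne' (Real.exp_ne_zero _),
    Real.log_exp]
  constructor <;> intro h <;> linarith

theorem claimValue_ae_eq {Ω : Type*} {mΩ : MeasurableSpace Ω} {Q : Measure Ω}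
    [IsProbabilityMeasure Q] {ℱ : Filtration ℝ≥0 mΩ} {σ ν θ : ℝ} (r : ℝ) {S₀ K : ℝ}
    (hS₀ : 0 < S₀) (hK : 0 < K) {X : ℝ≥0 → Ω → ℝ} (hX : IsVGProcess Q ℱ σ ν θ X)
    {t T : ℝ≥0} (htT : t < T) :
    claimValue Q ℱ r (stock S₀ r σ ν θ X) (cashOrNothing K) t T =ᵐ[Q] fun w =>
      Real.exp (-r * ((T : ℝ) - t)) * (vgLaw σ ν θ ((T : ℝ) - t)).real
        (Ioi (-moneyness (stock S₀ r σ ν θ X t w) K r (T - t) σ ν θ)) := by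
  have hXt : Measurable[ℱ t] (X t) := hX.adapted t
  have hD : Measurable fun w => X T w - X t w :=
    ((hX.adapted T).mono (ℱ.le T) le_rfl).sub (hXt.mono (ℱ.le t) le_rfl)
  have hφ : Measurable fun x : ℝ => -moneyness
      (S₀ * Real.exp ((r + martingaleAdj σ ν θ) * (t : ℝ) + x)) K r (T - t) σ ν θ := by
    unfold moneyness
    fun_prop
  have h := condExp_indicator_lt_of_indep (ℱ.le t) hD (hφ.comp hXt) (hX.indep t T htT)
    (Real.exp (-r * ((T : ℝ) - t)))
  rw [hX.law t T htT] at h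
  unfold claimValue
  simp only [cashOrNothing_stock r σ ν θ hS₀ hK X t T]
  exact h

end VarianceGamma

end

theorem mainTheorem3 {Ω : Type*} {mΩ : MeasurableSpace Ω} (Q : Measure Ω)
    [IsProbabilityMeasure Q] (ℱ : Filtration ℝ≥0 mΩ)
    (σ ν θ r S₀ K : ℝ) (hσ : 0 < σ) (hν : 0 < ν) (hS₀ : 0 < S₀) (hK : 0 < K)
    (hadj : 0 < 1 - θ * ν - σ ^ 2 * ν / 2)
    (X : ℝ≥0 → Ω → ℝ) (hX : VarianceGamma.IsVGProcess Q ℱ σ ν θ X)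
    (t T : ℝ≥0) (htT : t < T) (τ : ℝ) (hτ : τ = (T : ℝ) - (t : ℝ))
    (hα : ∀ m : ℤ, VarianceGamma.alpha τ ν ≠ (m : ℝ)) :
    Summable (fun n => VarianceGamma.singleTerm (VarianceGamma.alpha τ ν)
      (VarianceGamma.qPar σ ν θ) (VarianceGamma.thetaSigma σ θ) n) ∧
    Summable (fun n => VarianceGamma.singleTerm (VarianceGamma.alpha τ ν)
      (VarianceGamma.qPar σ ν θ) (-VarianceGamma.thetaSigma σ θ) n) ∧
    (∀ k : ℝ, k < 0 →
      Summable (fun n => VarianceGamma.doubleTerm (VarianceGamma.alpha τ ν) k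
        (VarianceGamma.qPar σ ν θ) (VarianceGamma.thetaSigma σ θ) n) ∧
      Summable (fun n => VarianceGamma.doubleTerm (VarianceGamma.alpha τ ν) k
        (VarianceGamma.qPar σ ν θ) (-VarianceGamma.thetaSigma σ θ) n)) ∧
    ∀ᵐ w ∂Q, ∀ k : ℝ,
      k = VarianceGamma.moneyness (VarianceGamma.stock S₀ r σ ν θ X t w) K r τ σ ν θ →
      (k < 0 →
        VarianceGamma.claimValue Q ℱ r (VarianceGamma.stock S₀ r σ ν θ X)
            (VarianceGamma.cashOrNothing K) t T w
          = VarianceGamma.cMinus r τ ν k (VarianceGamma.qPar σ ν θ)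
              (VarianceGamma.sigmaNu σ ν) (VarianceGamma.thetaSigma σ θ)) ∧
      (0 < k →
        VarianceGamma.claimValue Q ℱ r (VarianceGamma.stock S₀ r σ ν θ X)
            (VarianceGamma.cashOrNothing K) t T w
          = Real.exp (-r * τ)
            - VarianceGamma.cMinus r τ ν (-k) (VarianceGamma.qPar σ ν θ)
              (VarianceGamma.sigmaNu σ ν) (-VarianceGamma.thetaSigma σ θ)) ∧
      (k = 0 →
        VarianceGamma.claimValue Q ℱ r (VarianceGamma.stock S₀ r σ ν θ X)
            (VarianceGamma.cashOrNothing K) t T w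
          = VarianceGamma.cAtm r τ ν (VarianceGamma.qPar σ ν θ)
              (VarianceGamma.sigmaNu σ ν) (VarianceGamma.thetaSigma σ θ)) := by
  have ht : 0 < τ := by
    have : (t : ℝ) < T := by exact_mod_cast htT
    linarith
  have hq := VarianceGamma.qPar_pos θ hσ hν
  have ha := VarianceGamma.neg_half_lt_alpha ht hν
  refine ⟨VarianceGamma.summable_singleTerm θ hσ hν ht, ?_, fun k hk => ?_, ?_⟩
  · have h := VarianceGamma.summable_singleTerm (-θ) hσ hν ht
    rwa [VarianceGamma.qPar_neg, VarianceGamma.thetaSigma_neg] at h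
  · have h := fun ϑ => (VarianceGamma.hasSum_doubleTerm ϑ hα ha hq (neg_pos.2 hk)).summable
    simp only [neg_neg] at h
    exact ⟨h _, h _⟩
  · filter_upwards [VarianceGamma.claimValue_ae_eq r hS₀ hK hX htT] with w hw k hk
    -- The claim is now the discounted mass of (-k, ∞), and the sign of k selects the tail formula.
    rw [hw, ← hτ, ← hk]
    refine ⟨fun h => ?_, fun h => ?_, fun h => ?_⟩
    · rw [VarianceGamma.vgLaw_real_Ioi r θ hσ hν ht hα (neg_pos.2 h), neg_neg]
    · exact VarianceGamma.vgLaw_real_Ioi_neg r θ hσ hν ht hα h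
    · rw [h, neg_zero, VarianceGamma.vgLaw_real_Ioi_zero θ hσ hν ht, VarianceGamma.cAtm,
        VarianceGamma.prefactor_eq_exp_mul r, mul_assoc]
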